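/- Let $k$ be a commutative ring and let $A$ and $L$ be (associative unital) $k$-algebras. Let $\mathcal C$ be an $A$-coring with coproduct $\Delta_{\mathcal C}(c)=c^{(1)}\otimes_A c^{(2)}$ and counit $\epsilon_{\mathcal C}$, and let $\mathcal D$ be an $L$-coring with coproduct $\Delta_{\mathcal D}(d)=d_{(1)}\otimes_L d_{(2)}$ and counit $\epsilon_{\mathcal D}$. Write $\mathcal M_L$ for the category of right $L$-modules, and $\mathcal M^{\mathcal C}$, $\mathcal M^{\mathcal D}$ for the categories of right comodules. Coactions of $\mathcal C$ are written $\varrho^M(m)=m^{[0]}\otimes_A m^{[1]}$. Let $\mathcal D$ be a pure right coring extension of $\mathcal C$. This means that $\mathcal C$ is an $A$-$L$ bimodule and a $\mathcal C$-$\mathcal D$ bicomodule, with left coaction $\Delta_{\mathcal C}$ and some right coaction $\tau_{\mathcal C}(c)=c_{[0]}\otimes_L c_{[1]}$, and that for every right $\mathcal C$-comodule $(M,\varrho^M)$ the equalizer $$M\xrightarrow{\ \varrho^M\ } M\otimes_A\mathcal C\rightrightarrows M\otimes_A\mathcal C\otimes_A\mathcal C$$ of $\varrho^M\otimes_A\mathcal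 C$ and $M\otimes_A\Delta_{\mathcal C}$ in $\mathcal M_L$ is preserved by $-\otimes_L\mathcal D\otimes_L\mathcal D$. Here $M$ is a right $L$-module via $ml=m^{[0]}\epsilon_{\mathcal C}(m^{[1]}l)$. By purity there is a unique map $\tau_M:M\to M\otimes_L\mathcal D$ with $(\varrho^M\otimes_L\mathcal D)\circ\tau_M=(M\otimes_A\tau_{\mathcal C})\circ\varrho^M$, and it is a right $\mathcal D$-coaction. This defines the $k$-linear functor $U=-\Box_{\mathcal C}\mathcal C:\mathcal M^{\mathcal C}\to\mathcal M^{\mathcal D}$, which leaves the underlying $k$-modules and maps unchanged. Let $\Sigma$ be an $L$-$\mathcal C$ bicomodule, that is, an $L$-$A$ bimodule and a right $\mathcal C$-comodule with left $L$-linear coaction. For a right $\mathcal C$-comodule $M$, the right $L$-module structure of $\mathrm{Hom}^{\mathcal C}(\Sigma,M)$ is $(\varphi l)(x)=\varphi(lx)$; let $V=\mathrm{Hom}^{\mathcal C}(\Sigma,-)\otimes_L\mathcal D:\mathcal M^{\mathcal C}\to\mathcal M^{\mathcal D}$, with coaction $\mathrm{Hom}^{\mathcal C}(\Sigma,M)\otimes_L\Delta_{\mathcal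 D}$ on the value at $M$. Let $T=\mathrm{End}^{\mathcal C}(\Sigma)$, with the $L$-bimodule structure $(lt)(x)=l\,t(x)$, $(tl)(x)=t(lx)$. Let $\Sigma^*=\mathrm{Hom}_A(\Sigma,A)$, an $A$-$L$ bimodule via $(a\xi l)(x)=a\,\xi(lx)$, and $$\widetilde Q=\{\,q\in{}_A\mathrm{Hom}_L(\mathcal C,\Sigma^*)\ |\ c^{(1)}q(c^{(2)})(x)=q(c)(x^{[0]})\,x^{[1]}\ \text{ for all }x\in\Sigma,\ c\in\mathcal C\,\}.$$ Then the following hold. (1) The $k$-modules ${}_L\mathrm{Hom}_L(\mathcal D,T)$ ($L$-bimodule maps), ${}^{\mathcal C}\mathrm{End}^{\mathcal D}(\mathcal C)^{op}$ (endomorphisms of the bicomodule $\mathcal C$), ${}_L\mathrm{Hom}^{\mathcal D}(\mathcal D,\Sigma)$ (left $L$-linear right $\mathcal D$-comodule maps $\mathcal D\to U\Sigma$) and $\widetilde Q$ form a Morita context over $k$, $$\widetilde{\mathbb M}(\Sigma)=\big({}_L\mathrm{Hom}_L(\mathcal D,T),\ {}^{\mathcal C}\mathrm{End}^{\mathcal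 D}(\mathcal C)^{op},\ {}_L\mathrm{Hom}^{\mathcal D}(\mathcal D,\Sigma),\ \widetilde Q,\ \blacklozenge,\ \lozenge\big),$$ in which the products, the bimodule structures and the connecting maps $\blacklozenge:\widetilde Q\otimes{}_L\mathrm{Hom}^{\mathcal D}(\mathcal D,\Sigma)\to{}^{\mathcal C}\mathrm{End}^{\mathcal D}(\mathcal C)^{op}$ and $\lozenge:{}_L\mathrm{Hom}^{\mathcal D}(\mathcal D,\Sigma)\otimes\widetilde Q\to{}_L\mathrm{Hom}_L(\mathcal D,T)$ (tensor products over the respective algebras of the context) are given, for $v,v'\in{}_L\mathrm{Hom}_L(\mathcal D,T)$, $u,u'\in{}^{\mathcal C}\mathrm{End}^{\mathcal D}(\mathcal C)$, $p\in{}_L\mathrm{Hom}^{\mathcal D}(\mathcal D,\Sigma)$, $q\in\widetilde Q$, $d\in\mathcal D$, $c\in\mathcal C$, by $$\begin{aligned} (vv')(d)&=v(d_{(1)})\,v'(d_{(2)}), & (uu')(c)&=u'(u(c)),\\ (vp)(d)&=v(d_{(1)})\big(p(d_{(2)})\big), & (pu)(d)&=p(d)^{[0]}\,\epsilon_{\mathcal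 C}\big(u(p(d)^{[1]})\big),\\ (qv)(c)&=q(c_{[0]})\,v(c_{[1]})=q(c_{[0]})\circ v(c_{[1]}), & (uq)(c)&=q(u(c)), \end{aligned}$$ $$(q\mathbin{\blacklozenge}p)(c)=c^{(1)}q\big({c^{(2)}}_{[0]}\big)\big(p({c^{(2)}}_{[1]})\big)=q(c_{[0]})\big(p(c_{[1]})^{[0]}\big)\,p(c_{[1]})^{[1]},$$ $$(p\mathbin{\lozenge}q)(d)=p(d)^{[0]}\,q\big(p(d)^{[1]}\big)(-).$$ (2) There are $k$-linear isomorphisms $$\begin{aligned} \alpha_1&:{}_L\mathrm{Hom}_L(\mathcal D,T)\to\mathrm{Nat}(V,V)^{op}, & \alpha_2&:{}^{\mathcal C}\mathrm{End}^{\mathcal D}(\mathcal C)^{op}\to\mathrm{Nat}(U,U)^{op},\\ \alpha_3&:{}_L\mathrm{Hom}^{\mathcal D}(\mathcal D,\Sigma)\to\mathrm{Nat}(V,U), & \alpha_4&:\widetilde Q\to\mathrm{Nat}(U,V) \end{aligned}$$ that constitute an isomorphism of Morita contexts from $\widetilde{\mathbb M}(\Sigma)$ to the context $\big(\mathrm{Nat}(V,V)^{op},\mathrm{Nat}(U,U)^{op},\mathrm{Nat}(V,U),\mathrm{Nat}(U,V)\big)$,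 all of whose products, actions and connecting maps are the opposite composition of natural transformations, $fg=g\circ f$. -/

import Mathlib

open CategoryTheory MulOpposite
open scoped TensorProduct

universe u


namespace CoringMorita

noncomputable section

/-! ### Tensor products over noncommutative algebras

Throughout, `k` is the commutative ground ring. A right `R`-module is a module over `Rᵐᵒᵖ`,
so that `op r • m` stands for `m r`. -/

section BalTensor

/-- The relations `m r ⊗ n = m ⊗ r n`. -/
def balRel (k R M N : Type u) [CommRing k] [Ring R]
    [AddCommGroup M] [Module k M] [Module Rᵐᵒᵖ M]
    [AddCommGroup N] [Module k N] [Module R N] : Submodule k (M ⊗[k] N) :=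
  Submodule.span k {x | ∃ (m : M) (r : R) (n : N), x = (op r • m) ⊗ₜ[k] n - m ⊗ₜ[k] (r • n)}

/-- The tensor product `M ⊗_R N` of a right and a left module over a `k`-algebra `R`. -/
def BalTensor (k R M N : Type u) [CommRing k] [Ring R]
    [AddCommGroup M] [Module k M] [Module Rᵐᵒᵖ M]
    [AddCommGroup N] [Module k N] [Module R N] : Type u :=
  (M ⊗[k] N) ⧸ balRel k R M N

namespace BalTensor

variable {k R M N P M' N' : Type u} [CommRing k] [Ring R]
  [AddCommGroup M] [Module k M] [Module Rᵐᵒᵖ M]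
  [AddCommGroup N] [Module k N] [Module R N]
  [AddCommGroup P] [Module k P]
  [AddCommGroup M'] [Module k M'] [Module Rᵐᵒᵖ M']
  [AddCommGroup N'] [Module k N'] [Module R N']

instance : AddCommGroup (BalTensor k R M N) :=
  inferInstanceAs (AddCommGroup ((M ⊗[k] N) ⧸ balRel k R M N))

instance instModuleBase : Module k (BalTensor k R M N) :=
  inferInstanceAs (Module k ((M ⊗[k] N) ⧸ balRel k R M N))

variable (k R M N) in
/-- The canonical projection of `M ⊗_k N` onto `M ⊗_R N`. -/
def proj : M ⊗[k] N →ₗ[k] BalTensor k R M N :=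
  (balRel k R M N).mkQ

variable (k R) in
/-- The pure tensor `m ⊗_R n`. -/
def tmul (m : M) (n : N) : BalTensor k R M N :=
  proj k R M N (m ⊗ₜ[k] n)

theorem smul_tmul (m : M) (r : R) (n : N) :
    tmul k R (op r • m) n = tmul k R m (r • n) := by
  unfold tmul
  rw [← sub_eq_zero, ← map_sub]
  exact (Submodule.Quotient.mk_eq_zero _).2 (Submodule.subset_span ⟨m, r, n, rfl⟩)

/-- The linear map out of `M ⊗_R N` given by an `R`-balanced bilinear map. -/
def lift (f : M →ₗ[k] N →ₗ[k] P) (hf : ∀ (m : M) (r : R) (n : N), f (op r • m) n = f m (r • n)) :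
    BalTensor k R M N →ₗ[k] P :=
  (balRel k R M N).liftQ (TensorProduct.lift f) <| by
    refine Submodule.span_le.2 ?_
    rintro _ ⟨m, r, n, rfl⟩
    simp [hf]

@[simp] theorem lift_tmul (f : M →ₗ[k] N →ₗ[k] P)
    (hf : ∀ (m : M) (r : R) (n : N), f (op r • m) n = f m (r • n)) (m : M) (n : N) :
    lift f hf (tmul k R m n) = f m n := (rfl)

theorem add_tmul (m m' : M) (n : N) :
    tmul k R (m + m') n = tmul k R m n + tmul k R m' n := by
  simp [tmul, TensorProduct.add_tmul]

theorem tmul_add (m : M) (n n' : N) :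
    tmul k R m (n + n') = tmul k R m n + tmul k R m n' := by
  simp [tmul, TensorProduct.tmul_add]

theorem base_smul_tmul (c : k) (m : M) (n : N) :
    tmul k R (c • m) n = c • tmul k R m n := by
  simp only [tmul, ← TensorProduct.smul_tmul', map_smul]

theorem base_tmul_smul (c : k) (m : M) (n : N) :
    tmul k R m (c • n) = c • tmul k R m n := by
  simp only [tmul, TensorProduct.tmul_smul, map_smul]

@[elab_as_elim]
theorem induction {p : BalTensor k R M N → Prop} (x : BalTensor k R M N)
    (zero : p 0) (tmul : ∀ m n, p (tmul k R m n)) (add : ∀ x y, p x → p y → p (x + y)) : p x := by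
  obtain ⟨y, rfl⟩ : ∃ y, proj k R M N y = x := (balRel k R M N).mkQ_surjective x
  induction y using TensorProduct.induction_on with
  | zero => rw [map_zero]; exact zero
  | tmul m n => exact tmul m n
  | add a b ha hb => rw [map_add]; exact add _ _ ha hb

theorem hom_ext {f g : BalTensor k R M N →ₗ[k] P}
    (h : ∀ m n, f (tmul k R m n) = g (tmul k R m n)) : f = g := by
  ext x
  induction x using BalTensor.induction with
  | zero => simp
  | tmul m n => exact h m n
  | add x y hx hy => simp [hx, hy]

variable (k R M N) in
/-- The universal balanced bilinear map. -/
def mk : M →ₗ[k] N →ₗ[k] BalTensor k R M N :=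
  LinearMap.mk₂ k (tmul k R) add_tmul base_smul_tmul tmul_add base_tmul_smul

@[simp] theorem mk_apply (m : M) (n : N) : mk k R M N m n = tmul k R m n := (rfl)

theorem zero_tmul (n : N) : tmul k R (0 : M) n = 0 := by
  rw [← mk_apply, map_zero, LinearMap.zero_apply]

theorem tmul_zero (m : M) : tmul k R m (0 : N) = 0 := by
  rw [← mk_apply, map_zero]

/-- `f ⊗_R N` for a right `R`-linear map `f`. -/
def mapLeft (f : M →ₗ[k] M') (hf : ∀ (r : R) (m : M), f (op r • m) = op r • f m) :
    BalTensor k R M N →ₗ[k] BalTensor k R M' N :=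
  lift ((mk k R M' N).comp f) fun m r n => by simp [hf, smul_tmul]

@[simp] theorem mapLeft_tmul (f : M →ₗ[k] M')
    (hf : ∀ (r : R) (m : M), f (op r • m) = op r • f m) (m : M) (n : N) :
    mapLeft f hf (tmul k R m n) = tmul k R (f m) n := (rfl)

/-- `M ⊗_R g` for a left `R`-linear map `g`. -/
def mapRight (g : N →ₗ[k] N') (hg : ∀ (r : R) (n : N), g (r • n) = r • g n) :
    BalTensor k R M N →ₗ[k] BalTensor k R M N' :=
  lift ((mk k R M N').compl₂ g) fun m r n => by simp [hg, smul_tmul]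

@[simp] theorem mapRight_tmul (g : N →ₗ[k] N')
    (hg : ∀ (r : R) (n : N), g (r • n) = r • g n) (m : M) (n : N) :
    mapRight g hg (tmul k R m n) = tmul k R m (g n) := (rfl)

/-- `m ⊗ n ↦ m f(n)` for a left `R`-linear map `f : N → R`. -/
def contractRight [Algebra k R] [IsScalarTower k Rᵐᵒᵖ M]
    (f : N →ₗ[k] R) (hf : ∀ (r : R) (n : N), f (r • n) = r * f n) :
    BalTensor k R M N →ₗ[k] M :=
  lift (LinearMap.mk₂ k (fun m n => op (f n) • m)
    (fun m m' n => by simp) (fun c m n => by rw [smul_comm])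
    (fun m n n' => by simp [add_smul]) (fun c m n => by simp)) fun m r n => by
      simp [hf, mul_smul]

@[simp] theorem contractRight_tmul [Algebra k R] [IsScalarTower k Rᵐᵒᵖ M]
    (f : N →ₗ[k] R) (hf : ∀ (r : R) (n : N), f (r • n) = r * f n) (m : M) (n : N) :
    contractRight f hf (tmul k R m n) = op (f n) • m := (rfl)

/-- `m ⊗ n ↦ f(m) n` for a right `R`-linear map `f : M → R`. -/
def contractLeft [Algebra k R] [IsScalarTower k R N]
    (f : M →ₗ[k] R) (hf : ∀ (r : R) (m : M), f (op r • m) = f m * r) :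
    BalTensor k R M N →ₗ[k] N :=
  lift (LinearMap.mk₂ k (fun m n => f m • n)
    (fun m m' n => by simp [add_smul]) (fun c m n => by simp)
    (fun m n n' => by simp) (fun c m n => by rw [smul_comm])) fun m r n => by
      simp [hf, mul_smul]

@[simp] theorem contractLeft_tmul [Algebra k R] [IsScalarTower k R N]
    (f : M →ₗ[k] R) (hf : ∀ (r : R) (m : M), f (op r • m) = f m * r) (m : M) (n : N) :
    contractLeft f hf (tmul k R m n) = f m • n := (rfl)

/-- The left `S`-module structure `s (m ⊗ n) = s m ⊗ n`, where `M` is an `S`-`R` bimodule. -/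
instance (priority := 200) instModuleLeft {S : Type u} [Ring S] [Module S M] [SMulCommClass S k M]
    [SMulCommClass S Rᵐᵒᵖ M] : Module S (BalTensor k R M N) where
  smul s := mapLeft (Module.toModuleEnd k (S := S) M s) fun r m => smul_comm s (op r) m
  one_smul x := by
    induction x using BalTensor.induction with
    | zero => exact map_zero _
    | tmul m n => exact (mapLeft_tmul _ _ m n).trans (by simp)
    | add x y hx hy => exact (map_add _ x y).trans (congrArg₂ _ hx hy)
  mul_smul s t x := by
    induction x using BalTensor.induction with
    | zero =>
      refine (map_zero _).trans (Eq.symm ((congrArg _ (map_zero _)).trans (map_zero _)))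
    | tmul m n =>
      refine (mapLeft_tmul _ _ m n).trans (Eq.symm ((congrArg _ (mapLeft_tmul _ _ m n)).trans ?_))
      exact (mapLeft_tmul _ _ _ n).trans (by simp [mul_smul])
    | add x y hx hy =>
      refine (map_add _ x y).trans ((congrArg₂ _ hx hy).trans (Eq.symm ?_))
      exact (congrArg _ (map_add _ x y)).trans (map_add _ _ _)
  smul_zero s := map_zero _
  smul_add s := map_add _
  add_smul s t x := by
    induction x using BalTensor.induction with
    | zero => exact (map_zero _).trans (Eq.symm ((congrArg₂ _ (map_zero _) (map_zero _)).trans (add_zero _)))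
    | tmul m n =>
      refine (mapLeft_tmul _ _ m n).trans (Eq.symm ((congrArg₂ _ (mapLeft_tmul _ _ m n)
        (mapLeft_tmul _ _ m n)).trans ?_))
      simp [add_smul, add_tmul]
    | add x y hx hy =>
      refine (map_add _ x y).trans ((congrArg₂ _ hx hy).trans (Eq.symm ?_))
      refine (congrArg₂ _ (map_add _ x y) (map_add _ x y)).trans ?_
      exact add_add_add_comm _ _ _ _
  zero_smul x := by
    induction x using BalTensor.induction with
    | zero => exact map_zero _
    | tmul m n =>
      refine (mapLeft_tmul _ _ m n).trans ?_
      simp [← mk_apply]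
    | add x y hx hy => exact (map_add _ x y).trans ((congrArg₂ _ hx hy).trans (add_zero _))

theorem left_smul_tmul {S : Type u} [Ring S] [Module S M] [SMulCommClass S k M]
    [SMulCommClass S Rᵐᵒᵖ M] (s : S) (m : M) (n : N) :
    s • tmul k R m n = tmul k R (s • m) n :=
  mapLeft_tmul _ _ m n

/-- The right `S`-module structure `(m ⊗ n) s = m ⊗ n s`, where `N` is an `R`-`S` bimodule. -/
instance (priority := 300) instModuleRight {S : Type u} [Ring S] [Module Sᵐᵒᵖ N]
    [SMulCommClass Sᵐᵒᵖ k N] [SMulCommClass R Sᵐᵒᵖ N] : Module Sᵐᵒᵖ (BalTensor k R M N) where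
  smul s := mapRight (Module.toModuleEnd k (S := Sᵐᵒᵖ) N s) fun r n => (smul_comm r s n).symm
  one_smul x := by
    induction x using BalTensor.induction with
    | zero => exact map_zero _
    | tmul m n => exact (mapRight_tmul _ _ m n).trans (by simp)
    | add x y hx hy => exact (map_add _ x y).trans (congrArg₂ _ hx hy)
  mul_smul s t x := by
    induction x using BalTensor.induction with
    | zero =>
      refine (map_zero _).trans (Eq.symm ((congrArg _ (map_zero _)).trans (map_zero _)))
    | tmul m n =>
      refine (mapRight_tmul _ _ m n).trans (Eq.symm ((congrArg _ (mapRight_tmul _ _ m n)).trans ?_))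
      exact (mapRight_tmul _ _ m _).trans (by simp [mul_smul])
    | add x y hx hy =>
      refine (map_add _ x y).trans ((congrArg₂ _ hx hy).trans (Eq.symm ?_))
      exact (congrArg _ (map_add _ x y)).trans (map_add _ _ _)
  smul_zero s := map_zero _
  smul_add s := map_add _
  add_smul s t x := by
    induction x using BalTensor.induction with
    | zero => exact (map_zero _).trans (Eq.symm ((congrArg₂ _ (map_zero _) (map_zero _)).trans (add_zero _)))
    | tmul m n =>
      refine (mapRight_tmul _ _ m n).trans (Eq.symm ((congrArg₂ _ (mapRight_tmul _ _ m n)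
        (mapRight_tmul _ _ m n)).trans ?_))
      simp [add_smul, tmul_add]
    | add x y hx hy =>
      refine (map_add _ x y).trans ((congrArg₂ _ hx hy).trans (Eq.symm ?_))
      refine (congrArg₂ _ (map_add _ x y) (map_add _ x y)).trans ?_
      exact add_add_add_comm _ _ _ _
  zero_smul x := by
    induction x using BalTensor.induction with
    | zero => exact map_zero _
    | tmul m n =>
      refine (mapRight_tmul _ _ m n).trans ?_
      simp [← mk_apply]
    | add x y hx hy => exact (map_add _ x y).trans ((congrArg₂ _ hx hy).trans (add_zero _))

theorem right_smul_tmul {S : Type u} [Ring S] [Module Sᵐᵒᵖ N]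
    [SMulCommClass Sᵐᵒᵖ k N] [SMulCommClass R Sᵐᵒᵖ N] (s : S) (m : M) (n : N) :
    op s • tmul k R m n = tmul k R m (op s • n) :=
  mapRight_tmul _ _ m n

instance {S : Type u} [Ring S] [Algebra k S] [Module S M] [IsScalarTower k S M]
    [SMulCommClass S Rᵐᵒᵖ M] : IsScalarTower k S (BalTensor k R M N) where
  smul_assoc c s x := by
    induction x using BalTensor.induction with
    | zero => simp
    | tmul m n => simp only [left_smul_tmul, smul_assoc, base_smul_tmul]
    | add x y hx hy => simp only [smul_add, hx, hy]

instance {S : Type u} [Ring S] [Algebra k S] [Module Sᵐᵒᵖ N] [IsScalarTower k Sᵐᵒᵖ N]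
    [SMulCommClass R Sᵐᵒᵖ N] : IsScalarTower k Sᵐᵒᵖ (BalTensor k R M N) where
  smul_assoc c s x := by
    induction x using BalTensor.induction with
    | zero => simp
    | tmul m n =>
      induction s using MulOpposite.rec' with | _ s
      rw [← op_smul, right_smul_tmul, right_smul_tmul, op_smul, smul_assoc, base_tmul_smul]
    | add x y hx hy => simp only [smul_add, hx, hy]

instance {S Q : Type u} [Ring S] [Ring Q] [Module S M] [SMulCommClass S k M]
    [SMulCommClass S Rᵐᵒᵖ M] [Module Qᵐᵒᵖ N]
    [SMulCommClass Qᵐᵒᵖ k N] [SMulCommClass R Qᵐᵒᵖ N] :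
    SMulCommClass S Qᵐᵒᵖ (BalTensor k R M N) where
  smul_comm s q x := by
    induction x using BalTensor.induction with
    | zero => simp
    | tmul m n =>
      induction q using MulOpposite.rec' with | _ q
      simp only [right_smul_tmul, left_smul_tmul]
    | add x y hx hy => simp only [smul_add, hx, hy]

section
variable {S X : Type u} [Ring S] [Module Sᵐᵒᵖ N] [SMulCommClass Sᵐᵒᵖ k N]
    [SMulCommClass R k N] [SMulCommClass R Sᵐᵒᵖ N] [AddCommGroup X] [Module k X] [Module S X]

/-- The auxiliary map `m ⊗ n ↦ m ⊗ (n ⊗ x)` for fixed `x`. -/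
def assocAux : X →ₗ[k] BalTensor k R M N →ₗ[k] BalTensor k R M (BalTensor k S N X) :=
  LinearMap.mk₂ k (fun x y => mapRight ((mk k S N X).flip x)
      (fun r n => by simp [left_smul_tmul]) y)
    (fun x x' y => by
      induction y using BalTensor.induction with
      | zero => simp
      | tmul m n => simp [tmul_add]
      | add y z hy hz => simp only [map_add] at hy hz ⊢; rw [hy, hz]; abel)
    (fun c x y => by
      induction y using BalTensor.induction with
      | zero => simp
      | tmul m n => simp [base_tmul_smul]
      | add y z hy hz => simp only [map_add, smul_add] at hy hz ⊢; rw [hy, hz])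
    (fun _ _ _ => map_add _ _ _) (fun _ _ _ => map_smul _ _ _)

@[simp] theorem assocAux_tmul (x : X) (m : M) (n : N) :
    assocAux (S := S) x (tmul k R m n) = tmul k R m (tmul k S n x) := (rfl)

/-- The map `(m ⊗ n) ⊗ x ↦ m ⊗ (n ⊗ x)`. -/
def assocHom : BalTensor k S (BalTensor k R M N) X →ₗ[k] BalTensor k R M (BalTensor k S N X) :=
  lift assocAux.flip fun y s x => by
    induction y using BalTensor.induction with
    | zero => simp
    | tmul m n => simp [right_smul_tmul, smul_tmul]
    | add y z hy hz => simp only [smul_add, map_add, LinearMap.add_apply, hy, hz]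

/-- The auxiliary map `n ⊗ x ↦ (m ⊗ n) ⊗ x` for fixed `m`. -/
def assocInvAux : M →ₗ[k] BalTensor k S N X →ₗ[k] BalTensor k S (BalTensor k R M N) X :=
  LinearMap.mk₂ k (fun m y => mapLeft (mk k R M N m)
      (fun s n => by simp [right_smul_tmul]) y)
    (fun x x' y => by
      induction y using BalTensor.induction with
      | zero => simp
      | tmul m n => simp [add_tmul]
      | add y z hy hz => simp only [map_add] at hy hz ⊢; rw [hy, hz]; abel)
    (fun c x y => by
      induction y using BalTensor.induction with
      | zero => simp
      | tmul m n => simp [base_smul_tmul]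
      | add y z hy hz => simp only [map_add, smul_add] at hy hz ⊢; rw [hy, hz])
    (fun _ _ _ => map_add _ _ _) (fun _ _ _ => map_smul _ _ _)

@[simp] theorem assocInvAux_tmul (m : M) (n : N) (x : X) :
    assocInvAux (R := R) m (tmul k S n x) = tmul k S (tmul k R m n) x := (rfl)

/-- The map `m ⊗ (n ⊗ x) ↦ (m ⊗ n) ⊗ x`. -/
def assocInv : BalTensor k R M (BalTensor k S N X) →ₗ[k] BalTensor k S (BalTensor k R M N) X :=
  lift assocInvAux fun m r y => by
    induction y using BalTensor.induction with
    | zero => simp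
    | tmul n x => simp [left_smul_tmul, smul_tmul]
    | add y z hy hz => simp only [smul_add, map_add, hy, hz]

theorem assocHom_tmul (m : M) (n : N) (x : X) :
    assocHom (tmul k S (tmul k R m n) x) = tmul k R m (tmul k S n x) := (rfl)

theorem assocInv_tmul (m : M) (n : N) (x : X) :
    assocInv (tmul k R m (tmul k S n x)) = tmul k S (tmul k R m n) x := (rfl)

theorem tmul_induction_left {p : BalTensor k S (BalTensor k R M N) X → Prop}
    (z : BalTensor k S (BalTensor k R M N) X) (zero : p 0)
    (tmul : ∀ m n x, p (tmul k S (tmul k R m n) x)) (add : ∀ x y, p x → p y → p (x + y)) : p z := by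
  induction z using BalTensor.induction with
  | zero => exact zero
  | add _ _ h h' => exact add _ _ h h'
  | tmul y x =>
    induction y using BalTensor.induction with
    | zero => rw [← mk_apply, map_zero]; exact zero
    | add _ _ h h' => rw [add_tmul]; exact add _ _ h h'
    | tmul m n => exact tmul m n x

theorem tmul_induction_right {p : BalTensor k R M (BalTensor k S N X) → Prop}
    (z : BalTensor k R M (BalTensor k S N X)) (zero : p 0)
    (tmul : ∀ m n x, p (tmul k R m (tmul k S n x))) (add : ∀ x y, p x → p y → p (x + y)) : p z := by
  induction z using BalTensor.induction with
  | zero => exact zero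
  | add _ _ h h' => exact add _ _ h h'
  | tmul m y =>
    induction y using BalTensor.induction with
    | zero => rw [← mk_apply, map_zero]; exact zero
    | add _ _ h h' => rw [tmul_add]; exact add _ _ h h'
    | tmul n x => exact tmul m n x

/-- The canonical isomorphism `(M ⊗_R N) ⊗_S X → M ⊗_R (N ⊗_S X)`. -/
def assoc : BalTensor k S (BalTensor k R M N) X ≃ₗ[k] BalTensor k R M (BalTensor k S N X) :=
  { assocHom with
    invFun := assocInv
    left_inv := fun z => by
      change assocInv (assocHom z) = z
      induction z using tmul_induction_left with
      | zero => rw [map_zero, map_zero]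
      | tmul m n x => rfl
      | add y z hy hz => rw [map_add, map_add, hy, hz]
    right_inv := fun z => by
      change assocHom (assocInv z) = z
      induction z using tmul_induction_right with
      | zero => rw [map_zero, map_zero]
      | tmul m n x => rfl
      | add y z hy hz => rw [map_add, map_add, hy, hz] }

@[simp] theorem assoc_tmul (m : M) (n : N) (x : X) :
    assoc (tmul k S (tmul k R m n) x) = tmul k R m (tmul k S n x) := (rfl)

@[simp] theorem assoc_symm_tmul (m : M) (n : N) (x : X) :
    assoc.symm (tmul k R m (tmul k S n x)) = tmul k S (tmul k R m n) x := (rfl)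

end

end BalTensor

end BalTensor

section Naturality

namespace BalTensor

variable {k R S M N X M' N' M'' X' : Type u} [CommRing k] [Ring R] [Ring S]
  [AddCommGroup M] [Module k M] [Module Rᵐᵒᵖ M]
  [AddCommGroup M'] [Module k M'] [Module Rᵐᵒᵖ M']
  [AddCommGroup M''] [Module k M''] [Module Rᵐᵒᵖ M'']
  [AddCommGroup N] [Module k N] [Module R N]
  [AddCommGroup N'] [Module k N'] [Module R N']

theorem mapLeft_congr {f g : M →ₗ[k] M'} (h : f = g)
    (hf : ∀ (r : R) (m : M), f (op r • m) = op r • f m)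
    (hg : ∀ (r : R) (m : M), g (op r • m) = op r • g m) (x : BalTensor k R M N) :
    mapLeft f hf x = mapLeft g hg x := by
  subst h; rfl

theorem mapLeft_id (hf : ∀ (r : R) (m : M), (LinearMap.id (R := k) : M →ₗ[k] M) (op r • m) =
    op r • (LinearMap.id (R := k) : M →ₗ[k] M) m) (x : BalTensor k R M N) :
    mapLeft LinearMap.id hf x = x := by
  induction x using BalTensor.induction with
  | zero => simp
  | tmul m n => simp
  | add y z hy hz => rw [map_add, hy, hz]

theorem mapLeft_mapLeft (f : M →ₗ[k] M') (hf : ∀ (r : R) (m : M), f (op r • m) = op r • f m)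
    (g : M' →ₗ[k] M'') (hg : ∀ (r : R) (m : M'), g (op r • m) = op r • g m)
    (x : BalTensor k R M N) :
    mapLeft g hg (mapLeft f hf x) =
      mapLeft (g.comp f) (fun r m => by simp [hf, hg]) x := by
  induction x using BalTensor.induction with
  | zero => simp
  | tmul m n => simp
  | add y z hy hz => simp only [map_add, hy, hz]

theorem mapLeft_mapRight (f : M →ₗ[k] M') (hf : ∀ (r : R) (m : M), f (op r • m) = op r • f m)
    (g : N →ₗ[k] N') (hg : ∀ (r : R) (n : N), g (r • n) = r • g n) (x : BalTensor k R M N) :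
    mapLeft f hf (mapRight g hg x) = mapRight g hg (mapLeft f hf x) := by
  induction x using BalTensor.induction with
  | zero => simp
  | tmul m n => simp
  | add y z hy hz => simp only [map_add, hy, hz]

theorem mapLeft_op_smul [Module Sᵐᵒᵖ N] [SMulCommClass Sᵐᵒᵖ k N] [SMulCommClass R Sᵐᵒᵖ N]
    (f : M →ₗ[k] M') (hf : ∀ (r : R) (m : M), f (op r • m) = op r • f m) (s : S)
    (x : BalTensor k R M N) : mapLeft f hf (op s • x) = op s • mapLeft f hf x := by
  induction x using BalTensor.induction with
  | zero => simp
  | tmul m n => simp [right_smul_tmul]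
  | add y z hy hz => simp only [map_add, smul_add, hy, hz]

theorem mapRight_op_smul [Module Sᵐᵒᵖ N] [SMulCommClass Sᵐᵒᵖ k N] [SMulCommClass R Sᵐᵒᵖ N]
    [Module Sᵐᵒᵖ N'] [SMulCommClass Sᵐᵒᵖ k N'] [SMulCommClass R Sᵐᵒᵖ N']
    (g : N →ₗ[k] N') (hg : ∀ (r : R) (n : N), g (r • n) = r • g n)
    (hS : ∀ (s : S) (n : N), g (op s • n) = op s • g n) (s : S)
    (x : BalTensor k R M N) : mapRight g hg (op s • x) = op s • mapRight g hg x := by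
  induction x using BalTensor.induction with
  | zero => simp
  | tmul m n => simp [right_smul_tmul, hS]
  | add y z hy hz => simp only [map_add, smul_add, hy, hz]

theorem contractRight_mapLeft [Algebra k R] [IsScalarTower k Rᵐᵒᵖ M] [IsScalarTower k Rᵐᵒᵖ M']
    (f : N →ₗ[k] R) (hf : ∀ (r : R) (n : N), f (r • n) = r * f n)
    (g : M →ₗ[k] M') (hg : ∀ (r : R) (m : M), g (op r • m) = op r • g m)
    (x : BalTensor k R M N) :
    contractRight f hf (mapLeft g hg x) = g (contractRight f hf x) := by
  induction x using BalTensor.induction with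
  | zero => simp
  | tmul m n => simp [hg]
  | add y z hy hz => simp only [map_add, hy, hz]

theorem contractRight_smul [Algebra k R] [IsScalarTower k Rᵐᵒᵖ M]
    [Module S M] [SMulCommClass S k M] [SMulCommClass S Rᵐᵒᵖ M]
    (f : N →ₗ[k] R) (hf : ∀ (r : R) (n : N), f (r • n) = r * f n) (s : S)
    (x : BalTensor k R M N) :
    contractRight f hf (s • x) = s • contractRight f hf x := by
  induction x using BalTensor.induction with
  | zero => simp
  | tmul m n => simp [left_smul_tmul, smul_comm]
  | add y z hy hz => simp only [map_add, smul_add, hy, hz]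

section
variable [Module Sᵐᵒᵖ N] [SMulCommClass Sᵐᵒᵖ k N]
    [SMulCommClass R k N] [SMulCommClass R Sᵐᵒᵖ N] [AddCommGroup X] [Module k X] [Module S X]
    [AddCommGroup X'] [Module k X'] [Module S X']

theorem assoc_mapLeft_mapLeft (f : M →ₗ[k] M')
    (hf : ∀ (r : R) (m : M), f (op r • m) = op r • f m)
    (z : BalTensor k S (BalTensor k R M N) X) :
    assoc (mapLeft (mapLeft f hf) (mapLeft_op_smul f hf) z) = mapLeft f hf (assoc z) := by
  induction z using tmul_induction_left with
  | zero => simp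
  | tmul m n x => simp
  | add y z hy hz => simp only [map_add, hy, hz]

theorem assoc_mapLeft_mapRight
    [Module Sᵐᵒᵖ N'] [SMulCommClass Sᵐᵒᵖ k N'] [SMulCommClass R k N'] [SMulCommClass R Sᵐᵒᵖ N']
    (g : N →ₗ[k] N') (hg : ∀ (r : R) (n : N), g (r • n) = r • g n)
    (hS : ∀ (s : S) (n : N), g (op s • n) = op s • g n)
    (z : BalTensor k S (BalTensor k R M N) X) :
    assoc (mapLeft (mapRight g hg) (mapRight_op_smul g hg hS) z) =
      mapRight (mapLeft g hS) (fun r y => by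
        induction y using BalTensor.induction with
        | zero => simp
        | tmul n x => simp [left_smul_tmul, hg]
        | add y z hy hz => simp only [map_add, smul_add, hy, hz]) (assoc z) := by
  induction z using tmul_induction_left with
  | zero => simp
  | tmul m n x => simp
  | add y z hy hz => simp only [map_add, hy, hz]

theorem mapRight_smul
    (g : X →ₗ[k] X') (hg : ∀ (s : S) (x : X), g (s • x) = s • g x) (r : R)
    (y : BalTensor k S N X) : mapRight g hg (r • y) = r • mapRight g hg y := by
  induction y using BalTensor.induction with
  | zero => simp
  | tmul n x => simp [left_smul_tmul]
  | add y z hy hz => simp only [map_add, smul_add, hy, hz]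

end

end BalTensor

end Naturality

/-! ### Corings and comodules -/

section Comodules

open BalTensor

/-- A coring over the `k`-algebra `A`: a coalgebra in the category of `A`-`A` bimodules. -/
structure Coring (k A : Type u) [CommRing k] [Ring A] [Algebra k A] where
  carrier : Type u
  [addCommGroup : AddCommGroup carrier]
  [module : Module k carrier]
  [moduleLeft : Module A carrier]
  [moduleRight : Module Aᵐᵒᵖ carrier]
  [towerLeft : IsScalarTower k A carrier]
  [towerRight : IsScalarTower k Aᵐᵒᵖ carrier]
  [bimodule : SMulCommClass A Aᵐᵒᵖ carrier]
  comul : carrier →ₗ[k] BalTensor k A carrier carrier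
  comul_smul : ∀ (a : A) (c : carrier), comul (a • c) = a • comul c
  comul_op_smul : ∀ (a : A) (c : carrier), comul (op a • c) = op a • comul c
  counit : carrier →ₗ[k] A
  counit_smul : ∀ (a : A) (c : carrier), counit (a • c) = a * counit c
  counit_op_smul : ∀ (a : A) (c : carrier), counit (op a • c) = counit c * a
  coassoc : ∀ c : carrier, assoc (mapLeft comul comul_op_smul (comul c)) =
    mapRight comul comul_smul (comul c)
  counit_comul : ∀ c : carrier, contractLeft counit counit_op_smul (comul c) = c
  comul_counit : ∀ c : carrier, contractRight counit counit_smul (comul c) = c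

attribute [instance] Coring.addCommGroup Coring.module Coring.moduleLeft Coring.moduleRight
  Coring.towerLeft Coring.towerRight Coring.bimodule

variable {k A : Type u} [CommRing k] [Ring A] [Algebra k A]

/-- A right comodule over the `A`-coring `C`. -/
structure RComod (C : Coring k A) where
  carrier : Type u
  [addCommGroup : AddCommGroup carrier]
  [module : Module k carrier]
  [moduleRight : Module Aᵐᵒᵖ carrier]
  [towerRight : IsScalarTower k Aᵐᵒᵖ carrier]
  coact : carrier →ₗ[k] BalTensor k A carrier C.carrier
  coact_op_smul : ∀ (a : A) (m : carrier), coact (op a • m) = op a • coact m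
  coassoc : ∀ m : carrier, assoc (mapLeft coact coact_op_smul (coact m)) =
    mapRight C.comul C.comul_smul (coact m)
  counit : ∀ m : carrier, contractRight C.counit C.counit_smul (coact m) = m

attribute [instance] RComod.addCommGroup RComod.module RComod.moduleRight RComod.towerRight

namespace RComod

variable {C : Coring k A}

/-- The `k`-module `Hom^C(M, N)` of right `A`-linear maps `f` with `ρ ∘ f = (f ⊗ C) ∘ ρ`. -/
def homs (M N : RComod C) : Submodule k (M.carrier →ₗ[k] N.carrier) where
  carrier := {f | ∃ hf : ∀ (a : A) (m : M.carrier), f (op a • m) = op a • f m,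
    ∀ m, N.coact (f m) = mapLeft f hf (M.coact m)}
  zero_mem' := ⟨fun a m => by simp, fun m => by
    generalize M.coact m = x
    induction x using BalTensor.induction with
    | zero => simp
    | tmul m c => simp [zero_tmul]
    | add y z hy hz => rw [map_add, ← hy, ← hz]; simp⟩
  add_mem' := by
    rintro f g ⟨hf, hf'⟩ ⟨hg, hg'⟩
    refine ⟨fun a m => by simp [hf, hg], fun m => ?_⟩
    rw [LinearMap.add_apply, map_add, hf', hg']
    generalize M.coact m = x
    induction x using BalTensor.induction with
    | zero => simp
    | tmul m c => simp [add_tmul]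
    | add y z hy hz => simp only [map_add, ← hy, ← hz]; abel
  smul_mem' := by
    rintro r f ⟨hf, hf'⟩
    refine ⟨fun a m => by simp only [LinearMap.smul_apply, hf]; rw [smul_comm], fun m => ?_⟩
    rw [LinearMap.smul_apply, map_smul, hf']
    generalize M.coact m = x
    induction x using BalTensor.induction with
    | zero => simp
    | tmul m c => simp [base_smul_tmul]
    | add y z hy hz => simp only [map_add, ← hy, ← hz, smul_add]

/-- The category `M^C` of right `C`-comodules. -/
instance : Category (RComod C) where
  Hom M N := homs M N
  id M := ⟨LinearMap.id, fun _ _ => rfl, fun m => (mapLeft_id _ _).symm⟩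
  comp {M N P} f g := ⟨g.1.comp f.1, fun a m => by
      obtain ⟨hf, -⟩ := f.2
      obtain ⟨hg, -⟩ := g.2
      simp [hf, hg], fun m => by
      obtain ⟨hf, hf'⟩ := f.2
      obtain ⟨hg, hg'⟩ := g.2
      rw [LinearMap.comp_apply, hg', hf', mapLeft_mapLeft]⟩
  id_comp f := rfl
  comp_id f := rfl
  assoc f g h := rfl

/-- The linear map underlying a morphism of comodules. -/
def Hom.lin {M N : RComod C} (f : M ⟶ N) : M.carrier →ₗ[k] N.carrier :=
  Subtype.val f

theorem Hom.lin_op_smul {M N : RComod C} (f : M ⟶ N) (a : A) (m : M.carrier) :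
    Hom.lin f (op a • m) = op a • Hom.lin f m :=
  f.2.1 a m

theorem Hom.coact_lin {M N : RComod C} (f : M ⟶ N) (m : M.carrier) :
    N.coact (Hom.lin f m) = mapLeft (Hom.lin f) (Hom.lin_op_smul f) (M.coact m) :=
  f.2.2 m

/-- A morphism of comodules from a colinear map. -/
def Hom.mk {M N : RComod C} (f : M.carrier →ₗ[k] N.carrier)
    (hf : ∀ (a : A) (m : M.carrier), f (op a • m) = op a • f m)
    (hf' : ∀ m, N.coact (f m) = mapLeft f hf (M.coact m)) : M ⟶ N :=
  ⟨f, hf, hf'⟩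

@[simp] theorem Hom.lin_mk {M N : RComod C} (f : M.carrier →ₗ[k] N.carrier)
    (hf : ∀ (a : A) (m : M.carrier), f (op a • m) = op a • f m)
    (hf' : ∀ m, N.coact (f m) = mapLeft f hf (M.coact m)) : Hom.lin (Hom.mk f hf hf') = f := (rfl)

@[ext] theorem hom_ext {M N : RComod C} {f g : M ⟶ N} (h : ∀ m, Hom.lin f m = Hom.lin g m) :
    f = g :=
  Subtype.ext (LinearMap.ext h)

instance : Preadditive (RComod C) where
  homGroup M N := inferInstanceAs (AddCommGroup (homs M N))
  add_comp _ _ _ _ _ h := Subtype.ext (LinearMap.ext fun _ => map_add h.1 _ _)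
  comp_add _ _ _ _ _ _ := rfl

instance : Linear k (RComod C) where
  homModule M N := inferInstanceAs (Module k (homs M N))
  smul_comp _ _ _ r _ g := Subtype.ext (LinearMap.ext fun _ => map_smul g.1 r _)
  comp_smul _ _ _ _ _ _ := rfl

@[simp] theorem Hom.lin_add {M N : RComod C} (f g : M ⟶ N) :
    Hom.lin (f + g) = Hom.lin f + Hom.lin g := (rfl)

@[simp] theorem Hom.lin_zero {M N : RComod C} :
    Hom.lin (0 : M ⟶ N) = 0 := (rfl)

@[simp] theorem Hom.lin_smul {M N : RComod C} (r : k) (f : M ⟶ N) :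
    Hom.lin (r • f) = r • Hom.lin f := (rfl)

@[simp] theorem Hom.lin_comp {M N P : RComod C} (f : M ⟶ N) (g : N ⟶ P) (m : M.carrier) :
    Hom.lin (f ≫ g) m = Hom.lin g (Hom.lin f m) := (rfl)

@[simp] theorem Hom.lin_id {M : RComod C} (m : M.carrier) :
    Hom.lin (𝟙 M) m = m := (rfl)

end RComod

/-- An `L`-`C` bicomodule: a right `C`-comodule and left `L`-module whose coaction is left
`L`-linear. -/
structure BiComod (L : Type u) [Ring L] [Algebra k L] (C : Coring k A) extends RComod C where
  [moduleLeft : Module L carrier]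
  [towerLeft : IsScalarTower k L carrier]
  [bimodule : SMulCommClass L Aᵐᵒᵖ carrier]
  coact_smul : ∀ (l : L) (x : carrier), coact (l • x) = l • coact x

attribute [instance] BiComod.moduleLeft BiComod.towerLeft BiComod.bimodule

/-- The data making the `L`-coring `D` a right extension of the `A`-coring `C`: a right
`D`-coaction `τ` on the `A`-`L` bimodule `C` for which `C` is a `C`-`D` bicomodule with respect to
the left regular coaction. -/
structure CoringExtension {L : Type u} [Ring L] [Algebra k L] (C : Coring k A) (D : Coring k L)
    [Module Lᵐᵒᵖ C.carrier] [IsScalarTower k Lᵐᵒᵖ C.carrier]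
    [SMulCommClass A Lᵐᵒᵖ C.carrier] where
  coact : C.carrier →ₗ[k] BalTensor k L C.carrier D.carrier
  coact_op_smul : ∀ (l : L) (c : C.carrier), coact (op l • c) = op l • coact c
  coassoc : ∀ c : C.carrier, assoc (mapLeft coact coact_op_smul (coact c)) =
    mapRight D.comul D.comul_smul (coact c)
  counit : ∀ c : C.carrier, contractRight D.counit D.counit_smul (coact c) = c
  coact_smul : ∀ (a : A) (c : C.carrier), coact (a • c) = a • coact c
  comul_op_smul : ∀ (l : L) (c : C.carrier), C.comul (op l • c) = op l • C.comul c
  compat : ∀ c : C.carrier, assoc (mapLeft C.comul comul_op_smul (coact c)) =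
    mapRight coact coact_smul (C.comul c)

end Comodules

section Induced

/-! ### Induced coactions: if `N` is an `R`-`S` bimodule with a left `R`-linear right `D`-coaction,
then `M ⊗_R N` is a right `D`-comodule. -/

namespace BalTensor

variable {k R S : Type u} [CommRing k] [Ring R] [Algebra k R] [Ring S] [Algebra k S]

theorem contractRight_comp {M N N' : Type u}
    [AddCommGroup M] [Module k M] [Module Rᵐᵒᵖ M] [IsScalarTower k Rᵐᵒᵖ M]
    [AddCommGroup N] [Module k N] [Module R N] [AddCommGroup N'] [Module k N'] [Module R N']
    (f : N' →ₗ[k] R) (hf : ∀ (r : R) (n : N'), f (r • n) = r * f n)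
    (g : N →ₗ[k] N') (hg : ∀ (r : R) (n : N), g (r • n) = r • g n) (x : BalTensor k R M N) :
    contractRight (f.comp g) (fun r n => by simp [hf, hg]) x =
      contractRight f hf (mapRight g hg x) := by
  induction x using BalTensor.induction with
  | zero => simp
  | tmul m n => simp
  | add y z hy hz => simp only [map_add, hy, hz]

variable {M M' N N' X : Type u}
  [AddCommGroup M] [Module k M] [Module Rᵐᵒᵖ M]
  [AddCommGroup M'] [Module k M'] [Module Rᵐᵒᵖ M']
  [AddCommGroup N] [Module k N] [Module R N] [Module Sᵐᵒᵖ N] [IsScalarTower k R N]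
  [IsScalarTower k Sᵐᵒᵖ N] [SMulCommClass R Sᵐᵒᵖ N]
  [AddCommGroup N'] [Module k N'] [Module R N'] [Module Sᵐᵒᵖ N'] [IsScalarTower k R N']
  [IsScalarTower k Sᵐᵒᵖ N'] [SMulCommClass R Sᵐᵒᵖ N']
  [AddCommGroup X] [Module k X] [Module S X]

theorem contractRight_assoc (f : X →ₗ[k] S) (hf : ∀ (s : S) (x : X), f (s • x) = s * f x)
    (z : BalTensor k S (BalTensor k R M N) X) :
    contractRight f hf z = mapRight (contractRight f hf) (contractRight_smul f hf) (assoc z) := by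
  induction z using tmul_induction_left with
  | zero => simp
  | tmul m n x => simp [right_smul_tmul]
  | add y z hy hz => simp only [map_add, hy, hz]

theorem assoc_op_smul {Q : Type u} [Ring Q] [Algebra k Q] [Module Qᵐᵒᵖ X] [IsScalarTower k Qᵐᵒᵖ X]
    [SMulCommClass S Qᵐᵒᵖ X] (q : Q) (z : BalTensor k S (BalTensor k R M N) X) :
    assoc (op q • z) = op q • assoc z := by
  induction z using tmul_induction_left with
  | zero => simp
  | tmul m n x => simp [right_smul_tmul]
  | add y z hy hz => simp only [map_add, smul_add, hy, hz]

theorem assoc_symm_op_smul {Q : Type u} [Ring Q] [Algebra k Q] [Module Qᵐᵒᵖ X]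
    [IsScalarTower k Qᵐᵒᵖ X] [SMulCommClass S Qᵐᵒᵖ X] (q : Q)
    (z : BalTensor k R M (BalTensor k S N X)) :
    assoc.symm (op q • z) = op q • assoc.symm z := by
  rw [LinearEquiv.symm_apply_eq, assoc_op_smul, LinearEquiv.apply_symm_apply]

variable {D : Coring k S}

variable (M) in
/-- The coaction `m ⊗ n ↦ (m ⊗ n₀) ⊗ n₁` on `M ⊗_R N`. -/
def tensorCoact (τ : N →ₗ[k] BalTensor k S N D.carrier)
    (hR : ∀ (r : R) (n : N), τ (r • n) = r • τ n) :
    BalTensor k R M N →ₗ[k] BalTensor k S (BalTensor k R M N) D.carrier :=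
  assoc.symm.toLinearMap.comp (mapRight τ hR)

theorem tensorCoact_tmul (τ : N →ₗ[k] BalTensor k S N D.carrier)
    (hR : ∀ (r : R) (n : N), τ (r • n) = r • τ n) (m : M) (n : N) :
    tensorCoact M τ hR (tmul k R m n) = assoc.symm (tmul k R m (τ n)) := by
  simp [tensorCoact]

theorem tensorCoact_op_smul (τ : N →ₗ[k] BalTensor k S N D.carrier)
    (hR : ∀ (r : R) (n : N), τ (r • n) = r • τ n)
    (hS : ∀ (s : S) (n : N), τ (op s • n) = op s • τ n) (s : S) (z : BalTensor k R M N) :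
    tensorCoact M τ hR (op s • z) = op s • tensorCoact M τ hR z := by
  simp only [tensorCoact, LinearMap.comp_apply, LinearEquiv.coe_coe]
  rw [mapRight_op_smul τ hR hS, assoc_symm_op_smul]

theorem tensorCoact_smul {Q : Type u} [Ring Q] [Algebra k Q] [Module Q M] [IsScalarTower k Q M]
    [SMulCommClass Q Rᵐᵒᵖ M] (τ : N →ₗ[k] BalTensor k S N D.carrier)
    (hR : ∀ (r : R) (n : N), τ (r • n) = r • τ n) (q : Q) (z : BalTensor k R M N) :
    tensorCoact M τ hR (q • z) = q • tensorCoact M τ hR z := by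
  induction z using BalTensor.induction with
  | zero => simp
  | add y z hy hz => simp only [map_add, smul_add, hy, hz]
  | tmul m n =>
    rw [left_smul_tmul, tensorCoact_tmul, tensorCoact_tmul]
    generalize τ n = w
    induction w using BalTensor.induction with
    | zero => simp [tmul_zero]
    | tmul n d => simp [left_smul_tmul]
    | add y z hy hz => simp only [tmul_add, map_add, smul_add, hy, hz]

theorem tensorCoact_coassoc (τ : N →ₗ[k] BalTensor k S N D.carrier)
    (hR : ∀ (r : R) (n : N), τ (r • n) = r • τ n)
    (hS : ∀ (s : S) (n : N), τ (op s • n) = op s • τ n)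
    (hτ : ∀ n : N, assoc (mapLeft τ hS (τ n)) = mapRight D.comul D.comul_smul (τ n))
    (z : BalTensor k R M N) :
    assoc (mapLeft (tensorCoact M τ hR) (tensorCoact_op_smul τ hR hS) (tensorCoact M τ hR z)) =
      mapRight D.comul D.comul_smul (tensorCoact M τ hR z) := by
  induction z using BalTensor.induction with
  | zero => simp
  | add y z hy hz => simp only [map_add, hy, hz]
  | tmul m n =>
    have h1 : ∀ w : BalTensor k S N D.carrier,
        assoc (mapLeft (tensorCoact M τ hR) (tensorCoact_op_smul τ hR hS)
          (assoc.symm (tmul k R m w))) = assoc.symm (tmul k R m (assoc (mapLeft τ hS w))) := by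
      intro w
      induction w using BalTensor.induction with
      | zero => simp [tmul_zero]
      | add y z hy hz => simp only [map_add, tmul_add, hy, hz]
      | tmul n d =>
        rw [assoc_symm_tmul, mapLeft_tmul, mapLeft_tmul, tensorCoact_tmul]
        generalize τ n = v
        induction v using BalTensor.induction with
        | zero => simp [tmul_zero, zero_tmul]
        | add y z hy hz => simp only [map_add, tmul_add, add_tmul, hy, hz]
        | tmul n' d' => simp
    have h2 : ∀ w : BalTensor k S N D.carrier,
        mapRight D.comul D.comul_smul (assoc.symm (tmul k R m w)) =
          assoc.symm (tmul k R m (mapRight D.comul D.comul_smul w)) := by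
      intro w
      induction w using BalTensor.induction with
      | zero => simp [tmul_zero]
      | add y z hy hz => simp only [map_add, tmul_add, hy, hz]
      | tmul n d =>
        rw [assoc_symm_tmul, mapRight_tmul, mapRight_tmul]
        generalize D.comul d = v
        induction v using BalTensor.induction with
        | zero => simp [tmul_zero]
        | add y z hy hz => simp only [map_add, tmul_add, hy, hz]
        | tmul n' d' => simp
    rw [tensorCoact_tmul, h1, h2, hτ]

theorem tensorCoact_counit (τ : N →ₗ[k] BalTensor k S N D.carrier)
    (hR : ∀ (r : R) (n : N), τ (r • n) = r • τ n)
    (hτ : ∀ n : N, contractRight D.counit D.counit_smul (τ n) = n)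
    (z : BalTensor k R M N) :
    contractRight D.counit D.counit_smul (tensorCoact M τ hR z) = z := by
  induction z using BalTensor.induction with
  | zero => simp
  | add y z hy hz => simp only [map_add, hy, hz]
  | tmul m n =>
    rw [contractRight_assoc, tensorCoact_tmul, LinearEquiv.apply_symm_apply, mapRight_tmul, hτ]

theorem tensorCoact_mapLeft (τ : N →ₗ[k] BalTensor k S N D.carrier)
    (hR : ∀ (r : R) (n : N), τ (r • n) = r • τ n)
    (f : M →ₗ[k] M') (hf : ∀ (r : R) (m : M), f (op r • m) = op r • f m)
    (z : BalTensor k R M N) :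
    tensorCoact M' τ hR (mapLeft f hf z) =
      mapLeft (mapLeft f hf) (mapLeft_op_smul f hf) (tensorCoact M τ hR z) := by
  rw [tensorCoact, LinearMap.comp_apply, LinearEquiv.coe_coe, LinearEquiv.symm_apply_eq,
    assoc_mapLeft_mapLeft, tensorCoact, LinearMap.comp_apply, LinearEquiv.coe_coe,
    LinearEquiv.apply_symm_apply, mapLeft_mapRight]

theorem tensorCoact_mapRight (τ : N →ₗ[k] BalTensor k S N D.carrier)
    (hR : ∀ (r : R) (n : N), τ (r • n) = r • τ n)
    (τ' : N' →ₗ[k] BalTensor k S N' D.carrier)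
    (hR' : ∀ (r : R) (n : N'), τ' (r • n) = r • τ' n)
    (g : N →ₗ[k] N') (hg : ∀ (r : R) (n : N), g (r • n) = r • g n)
    (hS : ∀ (s : S) (n : N), g (op s • n) = op s • g n)
    (hgτ : ∀ n, τ' (g n) = mapLeft g hS (τ n))
    (z : BalTensor k R M N) :
    tensorCoact M τ' hR' (mapRight g hg z) =
      mapLeft (mapRight g hg) (mapRight_op_smul g hg hS) (tensorCoact M τ hR z) := by
  rw [tensorCoact, LinearMap.comp_apply, LinearEquiv.coe_coe, LinearEquiv.symm_apply_eq,
    assoc_mapLeft_mapRight g hg hS, tensorCoact, LinearMap.comp_apply, LinearEquiv.coe_coe,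
    LinearEquiv.apply_symm_apply]
  induction z using BalTensor.induction with
  | zero => simp
  | add y z hy hz => simp only [map_add, hy, hz]
  | tmul m n => simp [hgτ]

theorem tensorCoact_assoc {Q P : Type u} [Ring Q] [Algebra k Q]
    [AddCommGroup P] [Module k P] [Module Q P] [Module Rᵐᵒᵖ P] [IsScalarTower k Q P]
    [IsScalarTower k Rᵐᵒᵖ P] [SMulCommClass Q Rᵐᵒᵖ P] [Module Qᵐᵒᵖ M]
    (τ : N →ₗ[k] BalTensor k S N D.carrier)
    (hR : ∀ (r : R) (n : N), τ (r • n) = r • τ n)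
    (z : BalTensor k R (BalTensor k Q M P) N) :
    mapLeft assoc.toLinearMap (assoc_op_smul (k := k)) (tensorCoact (BalTensor k Q M P) τ hR z) =
      tensorCoact M (tensorCoact P τ hR) (tensorCoact_smul τ hR) (assoc z) := by
  induction z using tmul_induction_left with
  | zero => simp
  | add y z hy hz => simp only [map_add, hy, hz]
  | tmul m p n =>
    rw [tensorCoact_tmul, assoc_tmul, tensorCoact_tmul, tensorCoact_tmul]
    generalize τ n = w
    induction w using BalTensor.induction with
    | zero => simp [tmul_zero]
    | add y z hy hz => simp only [map_add, tmul_add, hy, hz]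
    | tmul n d => simp

end BalTensor

end Induced

section Functors

open BalTensor

variable {k A L : Type u} [CommRing k] [Ring A] [Algebra k A] [Ring L] [Algebra k L]
  {C : Coring k A} {D : Coring k L}

/-- The functor `- ⊗_L D ⊗_L D` on right `L`-module maps. -/
def tensorTwice (D : Coring k L) {X Y : Type u} [AddCommGroup X] [Module k X] [Module Lᵐᵒᵖ X]
    [AddCommGroup Y] [Module k Y] [Module Lᵐᵒᵖ Y] (f : X →ₗ[k] Y)
    (hf : ∀ (l : L) (x : X), f (op l • x) = op l • f x) :
    BalTensor k L (BalTensor k L X D.carrier) D.carrier →ₗ[k]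
      BalTensor k L (BalTensor k L Y D.carrier) D.carrier :=
  mapLeft (mapLeft f hf) (mapLeft_op_smul f hf)

/-- The right regular comodule. -/
def Coring.regular (D : Coring k L) : RComod D where
  carrier := D.carrier
  coact := D.comul
  coact_op_smul := D.comul_op_smul
  coassoc := D.coassoc
  counit := D.comul_counit

namespace CoringExtension

variable [Module Lᵐᵒᵖ C.carrier] [IsScalarTower k Lᵐᵒᵖ C.carrier] [SMulCommClass A Lᵐᵒᵖ C.carrier]
  (E : CoringExtension C D)

/-- `C` as a right `D`-comodule. -/
def comodC : RComod D where
  carrier := C.carrier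
  coact := E.coact
  coact_op_smul := E.coact_op_smul
  coassoc := E.coassoc
  counit := E.counit

/-- The right `L`-action `m l = m⁰ ε(m¹ l)` on a right `C`-comodule. -/
def act (_E : CoringExtension C D) (M : RComod C) (l : L) : M.carrier →ₗ[k] M.carrier :=
  (contractRight (C.counit.comp (Module.toModuleEnd k (S := Lᵐᵒᵖ) C.carrier (op l)))
    (fun a c => by simp [← smul_comm a (op l) c, C.counit_smul])).comp M.coact

theorem coact_act (M : RComod C) (l : L) (m : M.carrier) :
    M.coact (E.act M l m) = op l • M.coact m := by
  rw [act, LinearMap.comp_apply, ← contractRight_mapLeft _ _ M.coact M.coact_op_smul,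
    contractRight_assoc, M.coassoc]
  generalize M.coact m = x
  induction x using BalTensor.induction with
  | zero => simp
  | add y z hy hz => simp only [map_add, smul_add, hy, hz]
  | tmul m c =>
    rw [mapRight_tmul, mapRight_tmul, right_smul_tmul]
    congr 1
    rw [contractRight_comp C.counit C.counit_smul _
      (fun a c => by simp [smul_comm a (op l) c])]
    change contractRight C.counit C.counit_smul (op l • C.comul c) = _
    rw [← E.comul_op_smul, C.comul_counit]

theorem coact_injective (M : RComod C) : Function.Injective M.coact :=
  Function.LeftInverse.injective M.counit

/-- The comodule `M`, considered with its right `L`-module structure. -/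
def Res (_E : CoringExtension C D) (M : RComod C) : Type u := M.carrier

instance (M : RComod C) : AddCommGroup (E.Res M) := inferInstanceAs (AddCommGroup M.carrier)

instance (M : RComod C) : Module k (E.Res M) := inferInstanceAs (Module k M.carrier)

/-- The `C`-coaction as a map on `E.Res M`. -/
def rho (M : RComod C) : E.Res M →ₗ[k] BalTensor k A M.carrier C.carrier := M.coact

theorem rho_injective (M : RComod C) : Function.Injective (E.rho M) := coact_injective M

instance (M : RComod C) : SMul Lᵐᵒᵖ (E.Res M) := ⟨fun l m => E.act M (unop l) m⟩

theorem rho_op_smul (M : RComod C) (l : L) (m : E.Res M) :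
    E.rho M (op l • m) = op l • E.rho M m :=
  E.coact_act M l m

instance (M : RComod C) : Module Lᵐᵒᵖ (E.Res M) :=
  Function.Injective.module Lᵐᵒᵖ (E.rho M).toAddMonoidHom (E.rho_injective M)
    (fun l m => E.rho_op_smul M (unop l) m)

instance (M : RComod C) : IsScalarTower k Lᵐᵒᵖ (E.Res M) where
  smul_assoc c l m := E.rho_injective M <| by
    induction l using MulOpposite.rec' with | _ l
    rw [← op_smul, rho_op_smul, (E.rho M).map_smul, rho_op_smul, op_smul, smul_assoc]

/-- The map `ρ ⊗_A C : M ⊗_A C → M ⊗_A C ⊗_A C`. -/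
def rhoC (_E : CoringExtension C D) (M : RComod C) : BalTensor k A M.carrier C.carrier →ₗ[k]
    BalTensor k A M.carrier (BalTensor k A C.carrier C.carrier) :=
  assoc.toLinearMap.comp (mapLeft M.coact M.coact_op_smul)

/-- The map `M ⊗_A Δ : M ⊗_A C → M ⊗_A C ⊗_A C`. -/
def comulC (_E : CoringExtension C D) (M : RComod C) : BalTensor k A M.carrier C.carrier →ₗ[k]
    BalTensor k A M.carrier (BalTensor k A C.carrier C.carrier) :=
  mapRight C.comul C.comul_smul

theorem rhoC_op_smul (M : RComod C) (l : L) (x : BalTensor k A M.carrier C.carrier) :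
    E.rhoC M (op l • x) = op l • E.rhoC M x := by
  simp only [rhoC, LinearMap.comp_apply, LinearEquiv.coe_coe]
  rw [mapLeft_op_smul, assoc_op_smul]

theorem comulC_op_smul (M : RComod C) (l : L) (x : BalTensor k A M.carrier C.carrier) :
    E.comulC M (op l • x) = op l • E.comulC M x :=
  mapRight_op_smul _ _ E.comul_op_smul l x

/-- Purity: for every right `C`-comodule `M`, the equalizer
`M → M ⊗_A C ⇉ M ⊗_A C ⊗_A C` of right `L`-modules is preserved by `- ⊗_L D ⊗_L D`. -/
def IsPure : Prop :=
  ∀ M : RComod C,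
    Function.Injective (tensorTwice D (E.rho M) (E.rho_op_smul M)) ∧
    ∀ y, tensorTwice D (E.rhoC M) (E.rhoC_op_smul M) y =
        tensorTwice D (E.comulC M) (E.comulC_op_smul M) y →
      ∃ x, tensorTwice D (E.rho M) (E.rho_op_smul M) x = y

/-- `ρ ⊗_L D`. -/
def rhoD (M : RComod C) : BalTensor k L (E.Res M) D.carrier →ₗ[k]
    BalTensor k L (BalTensor k A M.carrier C.carrier) D.carrier :=
  mapLeft (E.rho M) (E.rho_op_smul M)

/-- The coaction `m ⊗ c ↦ (m ⊗ c₀) ⊗ c₁` on `M ⊗_A C`. -/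
def coactC (M : RComod C) : BalTensor k A M.carrier C.carrier →ₗ[k]
    BalTensor k L (BalTensor k A M.carrier C.carrier) D.carrier :=
  tensorCoact M.carrier E.coact E.coact_smul

theorem coactC_op_smul (M : RComod C) (l : L) (x : BalTensor k A M.carrier C.carrier) :
    E.coactC M (op l • x) = op l • E.coactC M x :=
  tensorCoact_op_smul _ _ E.coact_op_smul l x

/-- A comodule map, considered as a map of right `L`-modules. -/
def resMap {M N : RComod C} (f : M ⟶ N) : E.Res M →ₗ[k] E.Res N := RComod.Hom.lin f

theorem rho_resMap {M N : RComod C} (f : M ⟶ N) (m : E.Res M) :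
    E.rho N (E.resMap f m) = mapLeft (RComod.Hom.lin f) (RComod.Hom.lin_op_smul f) (E.rho M m) :=
  RComod.Hom.coact_lin f m

theorem resMap_op_smul {M N : RComod C} (f : M ⟶ N) (l : L) (m : E.Res M) :
    E.resMap f (op l • m) = op l • E.resMap f m :=
  E.rho_injective N <| by
    rw [rho_op_smul, rho_resMap, rho_resMap, rho_op_smul, mapLeft_op_smul]

variable {E}

theorem IsPure.rhoD_injective (hE : E.IsPure) (M : RComod C) : Function.Injective (E.rhoD M) := by
  intro x y hxy
  have h := (hE M).1 (a₁ := tensorCoact _ D.comul D.comul_smul x)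
    (a₂ := tensorCoact _ D.comul D.comul_smul y) (by
      unfold tensorTwice
      rw [← tensorCoact_mapLeft, ← tensorCoact_mapLeft]
      exact congrArg _ hxy)
  have := congrArg (contractRight D.counit D.counit_smul) h
  rwa [tensorCoact_counit _ _ D.comul_counit, tensorCoact_counit _ _ D.comul_counit] at this

theorem IsPure.exists_rhoD (hE : E.IsPure) (M : RComod C) (m : E.Res M) :
    ∃ t, E.rhoD M t = E.coactC M (E.rho M m) := by
  have key : mapLeft (E.rhoC M) (E.rhoC_op_smul M) (E.coactC M (E.rho M m)) =
      mapLeft (E.comulC M) (E.comulC_op_smul M) (E.coactC M (E.rho M m)) := by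
    have h1 : mapLeft (E.rhoC M) (E.rhoC_op_smul M) (E.coactC M (E.rho M m)) =
        tensorCoact M.carrier (tensorCoact C.carrier E.coact E.coact_smul)
          (tensorCoact_smul E.coact E.coact_smul) (E.rhoC M (E.rho M m)) := by
      refine Eq.symm ((tensorCoact_assoc E.coact E.coact_smul
        (mapLeft M.coact M.coact_op_smul (E.rho M m))).symm.trans ?_)
      exact (congrArg _ (tensorCoact_mapLeft E.coact E.coact_smul M.coact M.coact_op_smul
        (E.rho M m))).trans (mapLeft_mapLeft _ _ _ _ _)
    have h2 : mapLeft (E.comulC M) (E.comulC_op_smul M) (E.coactC M (E.rho M m)) =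
        tensorCoact M.carrier (tensorCoact C.carrier E.coact E.coact_smul)
          (tensorCoact_smul E.coact E.coact_smul) (E.comulC M (E.rho M m)) := by
      refine (tensorCoact_mapRight E.coact E.coact_smul _ _ C.comul C.comul_smul
        E.comul_op_smul (fun c => ?_) (E.rho M m)).symm
      rw [tensorCoact, LinearMap.comp_apply, LinearEquiv.coe_coe, LinearEquiv.symm_apply_eq]
      exact (E.compat c).symm
    rw [h1, h2]
    exact congrArg _ (M.coassoc m)
  obtain ⟨x, hx⟩ := (hE M).2 (tensorCoact _ D.comul D.comul_smul (E.coactC M (E.rho M m))) (by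
    unfold tensorTwice
    rw [← tensorCoact_mapLeft, ← tensorCoact_mapLeft, key])
  refine ⟨contractRight D.counit D.counit_smul x, ?_⟩
  have := congrArg (contractRight D.counit D.counit_smul) hx
  rw [tensorCoact_counit _ _ D.comul_counit] at this
  rw [← this]
  unfold tensorTwice
  rw [contractRight_mapLeft]
  rfl

/-- The `D`-coaction on a right `C`-comodule `M`: the element `τ_M(m)` of `M ⊗_L D` is the unique
preimage under `ρ ⊗_L D` of `m⁰ ⊗ τ(m¹)`, which is an element of `(M □_C C) ⊗_L D` by purity. -/
def IsPure.tau (hE : E.IsPure) (M : RComod C) :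
    E.Res M →ₗ[k] BalTensor k L (E.Res M) D.carrier where
  toFun m := (hE.exists_rhoD M m).choose
  map_add' m n :=
    have h := fun m => (hE.exists_rhoD M m).choose_spec
    hE.rhoD_injective M <| (h (m + n)).trans <|
      ((congrArg _ (map_add _ m n)).trans (map_add _ _ _)).trans
        ((map_add _ _ _).trans (congrArg₂ _ (h m) (h n))).symm
  map_smul' c m :=
    have h := fun m => (hE.exists_rhoD M m).choose_spec
    hE.rhoD_injective M <| (h (c • m)).trans <|
      ((congrArg _ (map_smul _ c m)).trans (map_smul _ _ _)).trans
        ((map_smul _ _ _).trans (congrArg _ (h m))).symm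

theorem IsPure.rhoD_tau (hE : E.IsPure) (M : RComod C) (m : E.Res M) :
    E.rhoD M (hE.tau M m) = E.coactC M (E.rho M m) :=
  (hE.exists_rhoD M m).choose_spec

theorem IsPure.tau_op_smul (hE : E.IsPure) (M : RComod C) (l : L) (m : E.Res M) :
    hE.tau M (op l • m) = op l • hE.tau M m := hE.rhoD_injective M <| by
  rw [hE.rhoD_tau, rho_op_smul, coactC, tensorCoact_op_smul _ _ E.coact_op_smul, rhoD,
    mapLeft_op_smul]
  exact congrArg _ (hE.rhoD_tau M m).symm

/-- The right `D`-comodule `U M = M □_C C ≅ M`. -/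
def IsPure.obj (hE : E.IsPure) (M : RComod C) : RComod D where
  carrier := E.Res M
  coact := hE.tau M
  coact_op_smul := hE.tau_op_smul M
  coassoc m := by
    rw [← LinearEquiv.eq_symm_apply]
    apply (hE M).1
    have h1 : tensorTwice D (E.rho M) (E.rho_op_smul M)
        (mapLeft (hE.tau M) (hE.tau_op_smul M) (hE.tau M m)) =
          mapLeft (E.coactC M) (E.coactC_op_smul M)
            (E.coactC M (E.rho M m)) := by
      rw [← hE.rhoD_tau, tensorTwice, mapLeft_mapLeft, rhoD, mapLeft_mapLeft]
      exact mapLeft_congr (LinearMap.ext (hE.rhoD_tau M)) _ _ _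
    have h2 : tensorTwice D (E.rho M) (E.rho_op_smul M)
        (assoc.symm (mapRight D.comul D.comul_smul (hE.tau M m))) =
          assoc.symm (mapRight D.comul D.comul_smul (E.coactC M (E.rho M m))) := by
      rw [← hE.rhoD_tau]
      exact (tensorCoact_mapLeft D.comul D.comul_smul _ (E.rho_op_smul M) _).symm
    rw [h1, h2, LinearEquiv.eq_symm_apply]
    exact tensorCoact_coassoc E.coact E.coact_smul E.coact_op_smul E.coassoc _
  counit m := E.rho_injective M <| by
    rw [← contractRight_mapLeft _ _ (E.rho M) (E.rho_op_smul M)]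
    refine (congrArg _ (hE.rhoD_tau M m)).trans ?_
    exact tensorCoact_counit E.coact E.coact_smul E.counit _

/-- The functor `U = - □_C C : M^C → M^D`; it does not change the underlying `k`-modules and
maps. -/
def IsPure.U (hE : E.IsPure) : RComod C ⥤ RComod D where
  obj M := hE.obj M
  map {M N} f := RComod.Hom.mk (M := hE.obj M) (N := hE.obj N) (E.resMap f) (E.resMap_op_smul f)
    fun m => hE.rhoD_injective N <| by
      refine (hE.rhoD_tau N _).trans ?_
      refine (congrArg _ (E.rho_resMap f m)).trans ?_
      refine (tensorCoact_mapLeft E.coact E.coact_smul _ _ _).trans ?_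
      refine (congrArg _ (hE.rhoD_tau M m).symm).trans ?_
      refine (mapLeft_mapLeft _ _ _ _ _).trans ?_
      refine Eq.trans ?_ (mapLeft_mapLeft _ _ _ _ _).symm
      exact mapLeft_congr (LinearMap.ext fun m => (E.rho_resMap f m).symm) _ _ _
  map_id _ := rfl
  map_comp _ _ := rfl

instance (hE : E.IsPure) : hE.U.Additive where
  map_add := rfl

instance (hE : E.IsPure) : hE.U.Linear k where
  map_smul _ _ := rfl

end CoringExtension

namespace BiComod

/-- Left multiplication by `l`, as an endomorphism of the right `C`-comodule `Σ`. -/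
def lmul (S : BiComod L C) (l : L) : S.toRComod ⟶ S.toRComod :=
  RComod.Hom.mk (Module.toModuleEnd k (S := L) S.carrier l) (fun a x => smul_comm l (op a) x)
    fun x => S.coact_smul l x

@[simp] theorem lin_lmul (S : BiComod L C) (l : L) (x : S.carrier) :
    RComod.Hom.lin (S.lmul l) x = l • x := (rfl)

/-- The right `L`-module structure `(φ l)(x) = φ(l x)` on `Hom^C(Σ, M)`. -/
instance (S : BiComod L C) (M : RComod C) : Module Lᵐᵒᵖ (S.toRComod ⟶ M) where
  smul l φ := S.lmul (unop l) ≫ φ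
  one_smul φ := RComod.hom_ext fun x => congrArg (RComod.Hom.lin φ) (one_smul L x)
  mul_smul l l' φ := RComod.hom_ext fun x =>
    congrArg (RComod.Hom.lin φ) (mul_smul (unop l') (unop l) x)
  smul_zero _ := Limits.comp_zero
  smul_add _ _ _ := Preadditive.comp_add _ _ _ _ _ _
  add_smul l l' φ := RComod.hom_ext fun x =>
    (congrArg (RComod.Hom.lin φ) (add_smul (unop l) (unop l') x)).trans (map_add _ _ _)
  zero_smul φ := RComod.hom_ext fun x =>
    (congrArg (RComod.Hom.lin φ) (zero_smul L x)).trans (map_zero _)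

theorem op_smul_def (S : BiComod L C) {M : RComod C} (l : L) (φ : S.toRComod ⟶ M) :
    op l • φ = S.lmul l ≫ φ := (rfl)

instance (S : BiComod L C) (M : RComod C) : IsScalarTower k Lᵐᵒᵖ (S.toRComod ⟶ M) where
  smul_assoc c l φ := RComod.hom_ext fun x =>
    (congrArg (RComod.Hom.lin φ) (smul_assoc c (unop l) x)).trans (map_smul _ _ _)

/-- The right `D`-comodule `Hom^C(Σ, M) ⊗_L D`. -/
def VObj (S : BiComod L C) (D : Coring k L) (M : RComod C) : RComod D where
  carrier := BalTensor k L (S.toRComod ⟶ M) D.carrier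
  coact := tensorCoact (S.toRComod ⟶ M) D.comul D.comul_smul
  coact_op_smul := tensorCoact_op_smul _ _ D.comul_op_smul
  coassoc := tensorCoact_coassoc _ _ D.comul_op_smul D.coassoc
  counit := tensorCoact_counit _ _ D.comul_counit

/-- Composition with a comodule map `f : M → N`, as a map `Hom^C(Σ, M) → Hom^C(Σ, N)`. -/
def postcomp (S : BiComod L C) {M N : RComod C} (f : M ⟶ N) :
    (S.toRComod ⟶ M) →ₗ[k] (S.toRComod ⟶ N) :=
  Linear.rightComp k S.toRComod f

theorem postcomp_op_smul (S : BiComod L C) {M N : RComod C} (f : M ⟶ N) (l : L)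
    (φ : S.toRComod ⟶ M) : S.postcomp f (op l • φ) = op l • S.postcomp f φ :=
  Category.assoc (S.lmul l) φ f

/-- The functor `V = Hom^C(Σ, -) ⊗_L D : M^C → M^D`. -/
def V (S : BiComod L C) (D : Coring k L) : RComod C ⥤ RComod D where
  obj M := S.VObj D M
  map {M N} f := RComod.Hom.mk (M := S.VObj D M) (N := S.VObj D N)
    (mapLeft (S.postcomp f) (S.postcomp_op_smul f))
    (mapLeft_op_smul (S.postcomp f) (S.postcomp_op_smul f))
    (fun z => tensorCoact_mapLeft D.comul D.comul_smul (S.postcomp f) (S.postcomp_op_smul f) z)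
  map_id _ := RComod.hom_ext fun z => mapLeft_id (fun _ _ => rfl) z
  map_comp f g := RComod.hom_ext fun z =>
    (mapLeft_mapLeft (S.postcomp f) (S.postcomp_op_smul f) (S.postcomp g)
      (S.postcomp_op_smul g) z).symm

instance (S : BiComod L C) (D : Coring k L) : (S.V D).Additive where
  map_add {_ _ f g} := Subtype.ext <| BalTensor.hom_ext fun φ d => by
    change tmul k L (φ ≫ (f + g)) d = tmul k L (φ ≫ f) d + tmul k L (φ ≫ g) d
    rw [Preadditive.comp_add, add_tmul]

instance (S : BiComod L C) (D : Coring k L) : (S.V D).Linear k where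
  map_smul f r := Subtype.ext <| BalTensor.hom_ext fun φ d => by
    change tmul k L (φ ≫ (r • f)) d = r • tmul k L (φ ≫ f) d
    rw [Linear.comp_smul, base_smul_tmul]

end BiComod

end Functors

/-! ### Morita contexts -/

section Morita

universe u₀ u₁ u₂ u₃ u₄ v₁ v₂ v₃ v₄

/-- A Morita context over `k` on the `k`-modules `R`, `S`, `P`, `Q`: algebra structures on `R` and
`S`, an `R`-`S` bimodule structure on `P`, an `S`-`R` bimodule structure on `Q`, and connecting
maps `Q ⊗_R P → S` and `P ⊗_S Q → R`, given as balanced bilinear maps, that are bimodule maps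
and satisfy the two associativity conditions. -/
structure MoritaContext (k : Type u₀) [CommRing k]
    (R : Type u₁) (S : Type u₂) (P : Type u₃) (Q : Type u₄)
    [AddCommGroup R] [Module k R] [AddCommGroup S] [Module k S]
    [AddCommGroup P] [Module k P] [AddCommGroup Q] [Module k Q] where
  mulR : R →ₗ[k] R →ₗ[k] R
  oneR : R
  mulR_assoc : ∀ r r' r'', mulR (mulR r r') r'' = mulR r (mulR r' r'')
  oneR_mul : ∀ r, mulR oneR r = r
  mulR_one : ∀ r, mulR r oneR = r
  mulS : S →ₗ[k] S →ₗ[k] S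
  oneS : S
  mulS_assoc : ∀ s s' s'', mulS (mulS s s') s'' = mulS s (mulS s' s'')
  oneS_mul : ∀ s, mulS oneS s = s
  mulS_one : ∀ s, mulS s oneS = s
  actRP : R →ₗ[k] P →ₗ[k] P
  mulR_actRP : ∀ r r' p, actRP (mulR r r') p = actRP r (actRP r' p)
  oneR_actRP : ∀ p, actRP oneR p = p
  actPS : P →ₗ[k] S →ₗ[k] P
  actPS_mulS : ∀ p s s', actPS p (mulS s s') = actPS (actPS p s) s'
  actPS_oneS : ∀ p, actPS p oneS = p
  actRP_actPS : ∀ r p s, actPS (actRP r p) s = actRP r (actPS p s)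
  actSQ : S →ₗ[k] Q →ₗ[k] Q
  mulS_actSQ : ∀ s s' q, actSQ (mulS s s') q = actSQ s (actSQ s' q)
  oneS_actSQ : ∀ q, actSQ oneS q = q
  actQR : Q →ₗ[k] R →ₗ[k] Q
  actQR_mulR : ∀ q r r', actQR q (mulR r r') = actQR (actQR q r) r'
  actQR_oneR : ∀ q, actQR q oneR = q
  actSQ_actQR : ∀ s q r, actQR (actSQ s q) r = actSQ s (actQR q r)
  pairQP : Q →ₗ[k] P →ₗ[k] S
  pairQP_balanced : ∀ q r p, pairQP (actQR q r) p = pairQP q (actRP r p)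
  pairQP_left : ∀ s q p, pairQP (actSQ s q) p = mulS s (pairQP q p)
  pairQP_right : ∀ q p s, pairQP q (actPS p s) = mulS (pairQP q p) s
  pairPQ : P →ₗ[k] Q →ₗ[k] R
  pairPQ_balanced : ∀ p s q, pairPQ (actPS p s) q = pairPQ p (actSQ s q)
  pairPQ_left : ∀ r p q, pairPQ (actRP r p) q = mulR r (pairPQ p q)
  pairPQ_right : ∀ p q r, pairPQ p (actQR q r) = mulR (pairPQ p q) r
  assocQPQ : ∀ q p q', actSQ (pairQP q p) q' = actQR q (pairPQ p q')
  assocPQP : ∀ p q p', actRP (pairPQ p q) p' = actPS p (pairQP q p')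

/-- An isomorphism of Morita contexts: four `k`-linear isomorphisms that are compatible with all
structure maps. -/
structure MoritaContext.Iso {k : Type u₀} [CommRing k]
    {R : Type u₁} {S : Type u₂} {P : Type u₃} {Q : Type u₄}
    [AddCommGroup R] [Module k R] [AddCommGroup S] [Module k S]
    [AddCommGroup P] [Module k P] [AddCommGroup Q] [Module k Q]
    {R' : Type v₁} {S' : Type v₂} {P' : Type v₃} {Q' : Type v₄}
    [AddCommGroup R'] [Module k R'] [AddCommGroup S'] [Module k S']
    [AddCommGroup P'] [Module k P'] [AddCommGroup Q'] [Module k Q']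
    (X : MoritaContext k R S P Q) (Y : MoritaContext k R' S' P' Q') where
  α₁ : R ≃ₗ[k] R'
  α₂ : S ≃ₗ[k] S'
  α₃ : P ≃ₗ[k] P'
  α₄ : Q ≃ₗ[k] Q'
  map_oneR : α₁ X.oneR = Y.oneR
  map_mulR : ∀ r r', α₁ (X.mulR r r') = Y.mulR (α₁ r) (α₁ r')
  map_oneS : α₂ X.oneS = Y.oneS
  map_mulS : ∀ s s', α₂ (X.mulS s s') = Y.mulS (α₂ s) (α₂ s')
  map_actRP : ∀ r p, α₃ (X.actRP r p) = Y.actRP (α₁ r) (α₃ p)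
  map_actPS : ∀ p s, α₃ (X.actPS p s) = Y.actPS (α₃ p) (α₂ s)
  map_actSQ : ∀ s q, α₄ (X.actSQ s q) = Y.actSQ (α₂ s) (α₄ q)
  map_actQR : ∀ q r, α₄ (X.actQR q r) = Y.actQR (α₄ q) (α₁ r)
  map_pairQP : ∀ q p, α₂ (X.pairQP q p) = Y.pairQP (α₄ q) (α₃ p)
  map_pairPQ : ∀ p q, α₁ (X.pairPQ p q) = Y.pairPQ (α₃ p) (α₄ q)

/-- The Morita context `(End(X)^op, End(Y)^op, Hom(X, Y), Hom(Y, X))` determined by two objects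
of a `k`-linear category; all products are opposite compositions, `f g = g ∘ f = f ≫ g`. -/
def MoritaContext.ofObjects (k : Type u₀) [CommRing k] {𝒞 : Type u₁} [Category.{u₂} 𝒞]
    [Preadditive 𝒞] [Linear k 𝒞] (X Y : 𝒞) :
    MoritaContext k (X ⟶ X) (Y ⟶ Y) (X ⟶ Y) (Y ⟶ X) where
  mulR := Linear.comp X X X
  oneR := 𝟙 X
  mulR_assoc := Category.assoc
  oneR_mul := Category.id_comp
  mulR_one := Category.comp_id
  mulS := Linear.comp Y Y Y
  oneS := 𝟙 Y
  mulS_assoc := Category.assoc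
  oneS_mul := Category.id_comp
  mulS_one := Category.comp_id
  actRP := Linear.comp X X Y
  mulR_actRP := Category.assoc
  oneR_actRP := Category.id_comp
  actPS := Linear.comp X Y Y
  actPS_mulS _ _ _ := (Category.assoc _ _ _).symm
  actPS_oneS := Category.comp_id
  actRP_actPS := Category.assoc
  actSQ := Linear.comp Y Y X
  mulS_actSQ := Category.assoc
  oneS_actSQ := Category.id_comp
  actQR := Linear.comp Y X X
  actQR_mulR _ _ _ := (Category.assoc _ _ _).symm
  actQR_oneR := Category.comp_id
  actSQ_actQR := Category.assoc
  pairQP := Linear.comp Y X Y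
  pairQP_balanced := Category.assoc
  pairQP_left := Category.assoc
  pairQP_right _ _ _ := (Category.assoc _ _ _).symm
  pairPQ := Linear.comp X Y X
  pairPQ_balanced := Category.assoc
  pairPQ_left := Category.assoc
  pairPQ_right _ _ _ := (Category.assoc _ _ _).symm
  assocQPQ := Category.assoc
  assocPQP := Category.assoc

end Morita

/-! ### The explicit context -/

section Explicit

open BalTensor

variable {k A L : Type u} [CommRing k] [Ring A] [Algebra k A] [Ring L] [Algebra k L]
  {C : Coring k A} {D : Coring k L}
  [Module Lᵐᵒᵖ C.carrier] [IsScalarTower k Lᵐᵒᵖ C.carrier] [SMulCommClass A Lᵐᵒᵖ C.carrier]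

/-- The `L`-bimodule maps `_L Hom_L(D, T)`, where `T = End^C(Σ)` has the `L`-bimodule structure
`(l t)(x) = l t(x)`, `(t l)(x) = t(l x)`. -/
def LHomL (D : Coring k L) (S : BiComod L C) :
    Submodule k (D.carrier →ₗ[k] (S.toRComod ⟶ S.toRComod)) where
  carrier := {v | (∀ (l : L) (d : D.carrier), v (l • d) = v d ≫ S.lmul l) ∧
    ∀ (l : L) (d : D.carrier), v (op l • d) = S.lmul l ≫ v d}
  zero_mem' := ⟨fun _ _ => by simp, fun _ _ => by simp⟩
  add_mem' {v w} hv hw := ⟨fun l d => by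
      rw [LinearMap.add_apply, LinearMap.add_apply, hv.1, hw.1, Preadditive.add_comp],
    fun l d => by
      rw [LinearMap.add_apply, LinearMap.add_apply, hv.2, hw.2, Preadditive.comp_add]⟩
  smul_mem' c v hv := ⟨fun l d => by
      rw [LinearMap.smul_apply, LinearMap.smul_apply, hv.1, Linear.smul_comp],
    fun l d => by
      rw [LinearMap.smul_apply, LinearMap.smul_apply, hv.2, Linear.comp_smul]⟩

/-- The map `C → C` underlying an endomorphism of the right `D`-comodule `C`. -/
def endLin (E : CoringExtension C D) : (E.comodC ⟶ E.comodC) →ₗ[k] C.carrier →ₗ[k] C.carrier :=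
  (RComod.homs E.comodC E.comodC).subtype

/-- The endomorphisms `^C End^D(C)` of the `C`-`D` bicomodule `C`. -/
def EndCD (E : CoringExtension C D) : Submodule k (E.comodC ⟶ E.comodC) where
  carrier := {u | ∃ hu : ∀ (a : A) (c : C.carrier), endLin E u (a • c) = a • endLin E u c,
    ∀ c : C.carrier, C.comul (endLin E u c) = mapRight (endLin E u) hu (C.comul c)}
  zero_mem' := ⟨fun a c => by simp, fun c => by
    generalize C.comul c = x
    induction x using BalTensor.induction with
    | zero => simp
    | tmul m c => simp [tmul_zero]
    | add y z hy hz => rw [map_add, ← hy, ← hz]; simp⟩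
  add_mem' := by
    rintro f g ⟨hf, hf'⟩ ⟨hg, hg'⟩
    refine ⟨fun a m => by simp [hf, hg], fun m => ?_⟩
    trans mapRight (endLin E f) hf (C.comul m) + mapRight (endLin E g) hg (C.comul m)
    · rw [← hf', ← hg', ← map_add]; rfl
    generalize C.comul m = x
    induction x using BalTensor.induction with
    | zero => simp
    | tmul m c => simp [tmul_add]
    | add y z hy hz => rw [map_add, map_add, map_add, ← hy, ← hz, add_add_add_comm]
  smul_mem' := by
    rintro r f ⟨hf, hf'⟩
    refine ⟨fun a m => by
      rw [(endLin E).map_smul, LinearMap.smul_apply, LinearMap.smul_apply, hf, smul_comm],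
      fun m => ?_⟩
    trans r • mapRight (endLin E f) hf (C.comul m)
    · rw [← hf', ← C.comul.map_smul]; rfl
    generalize C.comul m = x
    induction x using BalTensor.induction with
    | zero => simp
    | tmul m c => simp [base_tmul_smul]
    | add y z hy hz => rw [map_add, map_add, smul_add, hy, hz]

/-- The map `D → Σ` underlying a morphism of right `D`-comodules. -/
def colin {E : CoringExtension C D} (hE : E.IsPure) (S : BiComod L C) :
    (D.regular ⟶ hE.U.obj S.toRComod) →ₗ[k] D.carrier →ₗ[k] S.carrier :=
  (RComod.homs D.regular (hE.U.obj S.toRComod)).subtype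

/-- The left `L`-linear right `D`-colinear maps `_L Hom^D(D, Σ)`. -/
def LHomD {E : CoringExtension C D} (hE : E.IsPure) (S : BiComod L C) :
    Submodule k (D.regular ⟶ hE.U.obj S.toRComod) where
  carrier := {p | ∀ (l : L) (d : D.carrier), colin hE S p (l • d) = l • colin hE S p d}
  zero_mem' := fun l d => by simp
  add_mem' {p p'} hp hp' := fun l d => by
    rw [map_add, LinearMap.add_apply, LinearMap.add_apply, hp, hp', smul_add]
  smul_mem' c p hp := fun l d => by
    rw [(colin hE S).map_smul, LinearMap.smul_apply, LinearMap.smul_apply, hp, smul_comm]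

/-- The dual `Σ^* = Hom_A(Σ, A)`. -/
def Dual (S : BiComod L C) : Type u := S.carrier →ₗ[Aᵐᵒᵖ] A

instance (S : BiComod L C) : AddCommGroup (Dual S) :=
  inferInstanceAs (AddCommGroup (S.carrier →ₗ[Aᵐᵒᵖ] A))

instance (S : BiComod L C) : Module k (Dual S) :=
  inferInstanceAs (Module k (S.carrier →ₗ[Aᵐᵒᵖ] A))

/-- The underlying `k`-linear map of an element of `Σ^*`. -/
def dualLin (S : BiComod L C) : Dual S →ₗ[k] S.carrier →ₗ[k] A where
  toFun ξ := LinearMap.restrictScalars k (show S.carrier →ₗ[Aᵐᵒᵖ] A from ξ)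
  map_add' _ _ := rfl
  map_smul' _ _ := rfl

theorem dualLin_op_smul (S : BiComod L C) (ξ : Dual S) (a : A) (x : S.carrier) :
    dualLin S ξ (op a • x) = dualLin S ξ x * a :=
  LinearMap.map_smul (show S.carrier →ₗ[Aᵐᵒᵖ] A from ξ) (op a) x

/-- `c ↦ q(c)(x)`. -/
def evalAt {S : BiComod L C} (q : C.carrier →ₗ[k] Dual S) (x : S.carrier) : C.carrier →ₗ[k] A :=
  ((dualLin S).flip x).comp q

@[simp] theorem evalAt_apply {S : BiComod L C} (q : C.carrier →ₗ[k] Dual S) (x : S.carrier)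
    (c : C.carrier) : evalAt q x c = dualLin S (q c) x := (rfl)

/-- The `A`-`L` bimodule maps `q : C → Σ^* = Hom_A(Σ, A)` such that
`c⁽¹⁾ q(c⁽²⁾)(x) = q(c)(x⁽⁰⁾) x⁽¹⁾`, where `(a ξ l)(x) = a ξ(l x)`. -/
def Qtilde (S : BiComod L C) : Submodule k (C.carrier →ₗ[k] Dual S) where
  carrier := {q | ∃ hA : ∀ (x : S.carrier) (a : A) (c : C.carrier),
      evalAt q x (a • c) = a * evalAt q x c,
    (∀ (l : L) (c : C.carrier) (x : S.carrier), dualLin S (q (op l • c)) x = dualLin S (q c) (l • x)) ∧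
    ∀ (x : S.carrier) (c : C.carrier), contractRight (evalAt q x) (hA x) (C.comul c) =
      contractLeft (dualLin S (q c)) (dualLin_op_smul S (q c)) (S.coact x)}
  zero_mem' := by
    refine ⟨fun x a c => by simp, fun l c x => by simp, fun x c => ?_⟩
    trans 0
    · generalize C.comul c = y
      induction y using BalTensor.induction with
      | zero => simp
      | tmul m n => simp
      | add y z hy hz => rw [map_add, hy, hz, add_zero]
    · generalize S.coact x = y
      induction y using BalTensor.induction with
      | zero => simp
      | tmul m n => simp
      | add y z hy hz => rw [map_add, ← hy, ← hz, add_zero]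
  add_mem' := by
    rintro q q' ⟨hA, hL, hq⟩ ⟨hA', hL', hq'⟩
    refine ⟨fun x a c => ?_, fun l c x => by simp [hL, hL'], fun x c => ?_⟩
    · have h1 := hA x a c
      have h2 := hA' x a c
      simp only [evalAt_apply, LinearMap.add_apply, map_add] at h1 h2 ⊢
      rw [h1, h2, mul_add]
    · trans contractRight (evalAt q x) (hA x) (C.comul c) +
        contractRight (evalAt q' x) (hA' x) (C.comul c)
      · generalize C.comul c = y
        induction y using BalTensor.induction with
        | zero => simp
        | tmul m n => simp [add_smul]
        | add y z hy hz => rw [map_add, hy, hz, map_add, map_add, add_add_add_comm]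
      · rw [hq, hq']
        generalize S.coact x = y
        induction y using BalTensor.induction with
        | zero => simp
        | tmul m n => simp [add_smul]
        | add y z hy hz => rw [map_add, map_add, map_add, ← hy, ← hz, add_add_add_comm]
  smul_mem' := by
    rintro r q ⟨hA, hL, hq⟩
    refine ⟨fun x a c => ?_, fun l c x => by simp [hL], fun x c => ?_⟩
    · have h1 := hA x a c
      simp only [evalAt_apply, LinearMap.smul_apply, map_smul] at h1 ⊢
      rw [h1, mul_smul_comm]
    · trans r • contractRight (evalAt q x) (hA x) (C.comul c)
      · generalize C.comul c = y
        induction y using BalTensor.induction with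
        | zero => simp
        | tmul m n => simp
        | add y z hy hz => rw [map_add, hy, hz, map_add, smul_add]
      · rw [hq]
        generalize S.coact x = y
        induction y using BalTensor.induction with
        | zero => simp
        | tmul m n => simp
        | add y z hy hz => rw [map_add, map_add, smul_add, ← hy, ← hz]

/-- `d ↦ v(d₁) v'(d₂)`, the product taken in `T = End^C(Σ)`, that is, `v(d₁) ∘ v'(d₂)`. -/
def formulaVV {S : BiComod L C} (v v' : LHomL D S) (d : D.carrier) : S.toRComod ⟶ S.toRComod :=
  lift (LinearMap.mk₂ k (fun d d' => v'.1 d' ≫ v.1 d)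
      (fun _ _ _ => by rw [map_add, Preadditive.comp_add])
      (fun _ _ _ => by rw [map_smul, Linear.comp_smul])
      (fun _ _ _ => by rw [map_add, Preadditive.add_comp])
      (fun _ _ _ => by rw [map_smul, Linear.smul_comp]))
    (fun d l d' => by
      obtain ⟨-, hv⟩ := v.2
      obtain ⟨hv', -⟩ := v'.2
      simp only [LinearMap.mk₂_apply]
      rw [hv, hv', Category.assoc]) (D.comul d)

/-- `d ↦ v(d₁)(p(d₂))`. -/
def formulaVP {E : CoringExtension C D} {hE : E.IsPure} {S : BiComod L C} (v : LHomL D S)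
    (p : LHomD hE S) (d : D.carrier) : S.carrier :=
  lift (LinearMap.mk₂ k (fun d d' => RComod.Hom.lin (v.1 d) (colin hE S p.1 d'))
      (fun _ _ _ => by rw [map_add, RComod.Hom.lin_add, LinearMap.add_apply])
      (fun _ _ _ => by rw [map_smul, RComod.Hom.lin_smul, LinearMap.smul_apply])
      (fun _ _ _ => by rw [map_add, map_add])
      (fun _ _ _ => by rw [map_smul, map_smul]))
    (fun d l d' => by
      obtain ⟨-, hv⟩ := v.2
      simp only [LinearMap.mk₂_apply]
      rw [hv, p.2, RComod.Hom.lin_comp, BiComod.lin_lmul]) (D.comul d)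

/-- `d ↦ p(d)⁽⁰⁾ ε(u(p(d)⁽¹⁾))`. -/
def formulaPU {E : CoringExtension C D} {hE : E.IsPure} {S : BiComod L C} (p : LHomD hE S)
    (u : EndCD E) (d : D.carrier) : S.carrier :=
  contractRight (C.counit.comp (endLin E u.1))
    (fun a c => by
      obtain ⟨hu, -⟩ := u.2
      rw [LinearMap.comp_apply, hu, C.counit_smul, LinearMap.comp_apply])
    (S.coact (colin hE S p.1 d))

/-- `c ↦ (x ↦ q(c₀)(v(c₁)(x)))`. -/
def formulaQV (E : CoringExtension C D) {S : BiComod L C} (q : Qtilde S) (v : LHomL D S)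
    (c : C.carrier) (x : S.carrier) : A :=
  lift (LinearMap.mk₂ k (fun c d => dualLin S (q.1 c) (RComod.Hom.lin (v.1 d) x))
      (fun _ _ _ => by rw [map_add, map_add, LinearMap.add_apply])
      (fun _ _ _ => by rw [map_smul, map_smul, LinearMap.smul_apply])
      (fun _ _ _ => by rw [map_add, RComod.Hom.lin_add, LinearMap.add_apply, map_add])
      (fun r c d => by
        rw [map_smul, RComod.Hom.lin_smul, LinearMap.smul_apply]
        exact (dualLin S (q.1 c)).map_smul r _))
    (fun c l d => by
      obtain ⟨-, hL, -⟩ := q.2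
      obtain ⟨hv, -⟩ := v.2
      simp only [LinearMap.mk₂_apply]
      rw [hL, hv, RComod.Hom.lin_comp, BiComod.lin_lmul]) (E.coact c)

/-- The map `C ⊗_L D → A`, `c ⊗ d ↦ q(c)(p(d))`. -/
def evalQP {E : CoringExtension C D} {hE : E.IsPure} {S : BiComod L C} (q : Qtilde S)
    (p : LHomD hE S) : BalTensor k L C.carrier D.carrier →ₗ[k] A :=
  lift (LinearMap.mk₂ k (fun c d => dualLin S (q.1 c) (colin hE S p.1 d))
      (fun _ _ _ => by rw [map_add, map_add, LinearMap.add_apply])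
      (fun _ _ _ => by rw [map_smul, map_smul, LinearMap.smul_apply])
      (fun _ _ _ => by rw [map_add, map_add])
      (fun r c d => by
        rw [map_smul]
        exact (dualLin S (q.1 c)).map_smul r _))
    (fun c l d => by
      obtain ⟨-, hL, -⟩ := q.2
      simp only [LinearMap.mk₂_apply]
      rw [hL, p.2])

/-- `c ↦ c⁽¹⁾ q(c⁽²⁾₀)(p(c⁽²⁾₁))`. -/
def formulaQP {E : CoringExtension C D} {hE : E.IsPure} {S : BiComod L C} (q : Qtilde S)
    (p : LHomD hE S) (c : C.carrier) : C.carrier :=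
  contractRight ((evalQP q p).comp E.coact)
    (fun a c => by
      obtain ⟨hA, -, -⟩ := q.2
      rw [LinearMap.comp_apply, E.coact_smul, LinearMap.comp_apply]
      generalize E.coact c = y
      induction y using BalTensor.induction with
      | zero => simp
      | tmul c d =>
        rw [left_smul_tmul]
        exact hA (colin hE S p.1 d) a c
      | add y z hy hz => rw [smul_add, map_add, map_add, hy, hz, mul_add])
    (C.comul c)

/-- `c ↦ q(c₀)(p(c₁)⁽⁰⁾) p(c₁)⁽¹⁾`. -/
def formulaQPAlt {E : CoringExtension C D} {hE : E.IsPure} {S : BiComod L C} (q : Qtilde S)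
    (p : LHomD hE S) (c : C.carrier) : C.carrier :=
  lift (LinearMap.mk₂ k (fun c d =>
        contractLeft (dualLin S (q.1 c)) (dualLin_op_smul S (q.1 c)) (S.coact (colin hE S p.1 d)))
      (fun c c' d => by
        obtain ⟨hA, -, hq⟩ := q.2
        rw [← hq, ← hq, ← hq, map_add, map_add])
      (fun r c d => by
        obtain ⟨hA, -, hq⟩ := q.2
        rw [← hq, ← hq, map_smul, map_smul])
      (fun _ _ _ => by rw [map_add, map_add, map_add])
      (fun _ _ _ => by rw [map_smul, map_smul, map_smul]))
    (fun c l d => by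
      obtain ⟨-, hL, -⟩ := q.2
      simp only [LinearMap.mk₂_apply]
      rw [p.2, S.coact_smul]
      generalize S.coact (colin hE S p.1 d) = y
      induction y using BalTensor.induction with
      | zero => simp
      | tmul x c' => simp [left_smul_tmul, hL]
      | add y z hy hz => rw [smul_add, map_add, map_add, hy, hz])
    (E.coact c)

/-- `d ↦ (x ↦ p(d)⁽⁰⁾ q(p(d)⁽¹⁾)(x))`. -/
def formulaPQ {E : CoringExtension C D} {hE : E.IsPure} {S : BiComod L C} (p : LHomD hE S)
    (q : Qtilde S) (d : D.carrier) (x : S.carrier) : S.carrier :=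
  contractRight (evalAt q.1 x) (q.2.1 x) (S.coact (colin hE S p.1 d))

end Explicit

end

end CoringMorita

open CoringMorita

/-!
A natural transformation `V ⟶ G` is determined by its values on `1 ⊗ d` at `Σ`, by the Yoneda
argument, which computes `Nat(V, V)` and `Nat(V, U)`. By the universal property of the cofree
comodule `Hom^C(Σ, M) ⊗_L D`, a natural transformation `U ⟶ V` is a natural family of maps
`M → Hom^C(Σ, M)`. A natural family of `k`-linear maps `ζ_M : M → M`, or `M → Hom(Σ, M)`, is
evaluated at the regular comodule `C` and, through the coaction `M → M ⊗_A C`, at the cofree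
comodules; it is therefore `m ↦ m⁰ f(m¹)` with `f = ε ∘ ζ_C`. This computes `Nat(U, U)` and
`Nat(U, V)`. The context `M̃(Σ)` is the one transported from the context of natural
transformations along these bijections, and its structure maps are found by evaluating
compositions at `C` and `Σ`.
-/

namespace CoringMorita

noncomputable section

open BalTensor

namespace MoritaContext

variable {k R S P Q R' S' P' Q' : Type*} [CommRing k]
  [AddCommGroup R] [Module k R] [AddCommGroup S] [Module k S]
  [AddCommGroup P] [Module k P] [AddCommGroup Q] [Module k Q]
  [AddCommGroup R'] [Module k R'] [AddCommGroup S'] [Module k S']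
  [AddCommGroup P'] [Module k P'] [AddCommGroup Q'] [Module k Q']

/-- The Morita context obtained from `Y` by transport of structure along linear isomorphisms. -/
def transport (Y : MoritaContext k R' S' P' Q') (α₁ : R ≃ₗ[k] R') (α₂ : S ≃ₗ[k] S')
    (α₃ : P ≃ₗ[k] P') (α₄ : Q ≃ₗ[k] Q') : MoritaContext k R S P Q where
  mulR := (Y.mulR.compl₁₂ α₁.toLinearMap α₁.toLinearMap).compr₂ α₁.symm.toLinearMap
  oneR := α₁.symm Y.oneR
  mulR_assoc _ _ _ := by simp [Y.mulR_assoc]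
  oneR_mul _ := by simp [Y.oneR_mul]
  mulR_one _ := by simp [Y.mulR_one]
  mulS := (Y.mulS.compl₁₂ α₂.toLinearMap α₂.toLinearMap).compr₂ α₂.symm.toLinearMap
  oneS := α₂.symm Y.oneS
  mulS_assoc _ _ _ := by simp [Y.mulS_assoc]
  oneS_mul _ := by simp [Y.oneS_mul]
  mulS_one _ := by simp [Y.mulS_one]
  actRP := (Y.actRP.compl₁₂ α₁.toLinearMap α₃.toLinearMap).compr₂ α₃.symm.toLinearMap
  mulR_actRP _ _ _ := by simp [Y.mulR_actRP]
  oneR_actRP _ := by simp [Y.oneR_actRP]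
  actPS := (Y.actPS.compl₁₂ α₃.toLinearMap α₂.toLinearMap).compr₂ α₃.symm.toLinearMap
  actPS_mulS _ _ _ := by simp [Y.actPS_mulS]
  actPS_oneS _ := by simp [Y.actPS_oneS]
  actRP_actPS _ _ _ := by simp [Y.actRP_actPS]
  actSQ := (Y.actSQ.compl₁₂ α₂.toLinearMap α₄.toLinearMap).compr₂ α₄.symm.toLinearMap
  mulS_actSQ _ _ _ := by simp [Y.mulS_actSQ]
  oneS_actSQ _ := by simp [Y.oneS_actSQ]
  actQR := (Y.actQR.compl₁₂ α₄.toLinearMap α₁.toLinearMap).compr₂ α₄.symm.toLinearMap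
  actQR_mulR _ _ _ := by simp [Y.actQR_mulR]
  actQR_oneR _ := by simp [Y.actQR_oneR]
  actSQ_actQR _ _ _ := by simp [Y.actSQ_actQR]
  pairQP := (Y.pairQP.compl₁₂ α₄.toLinearMap α₃.toLinearMap).compr₂ α₂.symm.toLinearMap
  pairQP_balanced _ _ _ := by simp [Y.pairQP_balanced]
  pairQP_left _ _ _ := by simp [Y.pairQP_left]
  pairQP_right _ _ _ := by simp [Y.pairQP_right]
  pairPQ := (Y.pairPQ.compl₁₂ α₃.toLinearMap α₄.toLinearMap).compr₂ α₁.symm.toLinearMap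
  pairPQ_balanced _ _ _ := by simp [Y.pairPQ_balanced]
  pairPQ_left _ _ _ := by simp [Y.pairPQ_left]
  pairPQ_right _ _ _ := by simp [Y.pairPQ_right]
  assocQPQ _ _ _ := by simp [Y.assocQPQ]
  assocPQP _ _ _ := by simp [Y.assocPQP]

/-- The isomorphism from the transported context to the original one. -/
def transportIso (Y : MoritaContext k R' S' P' Q') (α₁ : R ≃ₗ[k] R') (α₂ : S ≃ₗ[k] S')
    (α₃ : P ≃ₗ[k] P') (α₄ : Q ≃ₗ[k] Q') : (Y.transport α₁ α₂ α₃ α₄).Iso Y where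
  α₁ := α₁
  α₂ := α₂
  α₃ := α₃
  α₄ := α₄
  map_oneR := by simp [transport]
  map_mulR _ _ := by simp [transport]
  map_oneS := by simp [transport]
  map_mulS _ _ := by simp [transport]
  map_actRP _ _ := by simp [transport]
  map_actPS _ _ := by simp [transport]
  map_actSQ _ _ := by simp [transport]
  map_actQR _ _ := by simp [transport]
  map_pairQP _ _ := by simp [transport]
  map_pairPQ _ _ := by simp [transport]

end MoritaContext

namespace BalTensor

variable {k R M N X : Type u} [CommRing k] [Ring R] [AddCommGroup M] [Module k M] [Module Rᵐᵒᵖ M]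
  [AddCommGroup N] [Module k N] [Module R N] [AddCommGroup X] [Module k X]

theorem eq_lift {f : BalTensor k R M N →ₗ[k] X} {b : M →ₗ[k] N →ₗ[k] X}
    {hb : ∀ (m : M) (r : R) (n : N), b (op r • m) n = b m (r • n)}
    (h : ∀ m n, f (tmul k R m n) = b m n) (z : BalTensor k R M N) : f z = lift b hb z :=
  LinearMap.congr_fun (hom_ext h) z

theorem mapLeft_zero [Module Rᵐᵒᵖ X]
    (h : ∀ (r : R) (m : M), (0 : M →ₗ[k] X) (op r • m) = op r • (0 : M →ₗ[k] X) m)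
    (w : BalTensor k R M N) : mapLeft (0 : M →ₗ[k] X) h w = 0 :=
  LinearMap.congr_fun (hom_ext (g := (0 : _ →ₗ[k] BalTensor k R X N)) fun _ n => zero_tmul n) w

theorem mapLeft_add [Module Rᵐᵒᵖ X] {f g : M →ₗ[k] X}
    (hf : ∀ (r : R) (m : M), f (op r • m) = op r • f m)
    (hg : ∀ (r : R) (m : M), g (op r • m) = op r • g m)
    (h : ∀ (r : R) (m : M), (f + g) (op r • m) = op r • (f + g) m) (w : BalTensor k R M N) :
    mapLeft (f + g) h w = mapLeft f hf w + mapLeft g hg w :=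
  LinearMap.congr_fun (hom_ext (g := mapLeft f hf + mapLeft g hg) fun _ n => add_tmul _ _ n) w

theorem mk_op_smul {S : Type u} [Ring S] [Module Sᵐᵒᵖ N] [SMulCommClass Sᵐᵒᵖ k N]
    [SMulCommClass R Sᵐᵒᵖ N] (m : M) (s : S) (n : N) :
    mk k R M N m (op s • n) = op s • mk k R M N m n :=
  (right_smul_tmul s m n).symm

theorem assoc_symm_tmul_eq_mapLeft {S : Type u} [Ring S] [Module Sᵐᵒᵖ N] [SMulCommClass Sᵐᵒᵖ k N]
    [SMulCommClass R k N] [SMulCommClass R Sᵐᵒᵖ N] [Module S X] (m : M) (w : BalTensor k S N X) :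
    assoc.symm (tmul k R m w) = mapLeft (mk k R M N m) (mk_op_smul m) w :=
  LinearMap.congr_fun (hom_ext (f := assoc.symm.toLinearMap.comp (mk k R M _ m))
    (g := mapLeft (mk k R M N m) (mk_op_smul m)) fun n x => assoc_symm_tmul m n x) w

variable [Algebra k R]

theorem contractRight_op_smul [IsScalarTower k Rᵐᵒᵖ M] [Module Rᵐᵒᵖ N] [SMulCommClass Rᵐᵒᵖ k N]
    [SMulCommClass R Rᵐᵒᵖ N] (f : N →ₗ[k] R) (hf : ∀ (r : R) (n : N), f (r • n) = r * f n)
    (hf' : ∀ (r : R) (n : N), f (op r • n) = f n * r) (r : R) (z : BalTensor k R M N) :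
    contractRight f hf (op r • z) = op r • contractRight f hf z := by
  induction z using BalTensor.induction with
  | zero => simp only [smul_zero, map_zero]
  | tmul m n => rw [right_smul_tmul, contractRight_tmul, hf', op_mul, mul_smul, contractRight_tmul]
  | add y z hy hz => simp only [smul_add, map_add, hy, hz]

theorem contractLeft_mapLeft [Module Rᵐᵒᵖ X] [IsScalarTower k R N]
    (f : X →ₗ[k] R) (hf : ∀ (r : R) (x : X), f (op r • x) = f x * r)
    (g : M →ₗ[k] X) (hg : ∀ (r : R) (m : M), g (op r • m) = op r • g m)
    (w : BalTensor k R M N) :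
    contractLeft f hf (mapLeft g hg w) =
      contractLeft (f.comp g) (fun r m => (congrArg f (hg r m)).trans (hf r (g m))) w :=
  LinearMap.congr_fun (hom_ext (f := (contractLeft f hf).comp (mapLeft g hg))
    (g := contractLeft (f.comp g) _) fun _ _ => rfl) w

theorem apply_contractRight [IsScalarTower k Rᵐᵒᵖ M] [IsScalarTower k R N]
    (f : M →ₗ[k] R) (hf : ∀ (r : R) (m : M), f (op r • m) = f m * r)
    (g : N →ₗ[k] R) (hg : ∀ (r : R) (n : N), g (r • n) = r * g n) (z : BalTensor k R M N) :
    f (contractRight g hg z) = g (contractLeft f hf z) :=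
  LinearMap.congr_fun (hom_ext (f := f.comp (contractRight g hg)) (g := g.comp (contractLeft f hf))
    fun m n => (hf (g n) m).trans (hg (f m) n).symm) z

theorem mapLeft_eq_tmul_contractLeft [Module Rᵐᵒᵖ X] [IsScalarTower k R N] (x : X)
    (f : M →ₗ[k] R) (hf : ∀ (r : R) (m : M), f (op r • m) = f m * r)
    (g : M →ₗ[k] X) (hg : ∀ (r : R) (m : M), g (op r • m) = op r • g m)
    (hgf : ∀ m, g m = op (f m) • x) (w : BalTensor k R M N) :
    mapLeft g hg w = tmul k R x (contractLeft f hf w) :=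
  LinearMap.congr_fun (hom_ext (g := (mk k R X N x).comp (contractLeft f hf)) fun m n => by
    rw [mapLeft_tmul, hgf, smul_tmul]
    rfl) w

end BalTensor

section Cofree

variable {k A : Type u} [CommRing k] [Ring A] [Algebra k A] {C : Coring k A}
  {N : Type u} [AddCommGroup N] [Module k N] [Module Aᵐᵒᵖ N] [IsScalarTower k Aᵐᵒᵖ N]

namespace Coring

variable (C)

variable (N) in
/-- The cofree right comodule `N ⊗_A C` on a right `A`-module `N`. -/
def cofree : RComod C where
  carrier := BalTensor k A N C.carrier
  coact := tensorCoact N C.comul C.comul_smul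
  coact_op_smul := tensorCoact_op_smul _ _ C.comul_op_smul
  coassoc := tensorCoact_coassoc _ _ C.comul_op_smul C.coassoc
  counit := tensorCoact_counit _ _ C.comul_counit

variable (N) in
/-- The counit `N ⊗_A ε : N ⊗_A C → N` of the cofree comodule. -/
def cofreeCounit : BalTensor k A N C.carrier →ₗ[k] N :=
  contractRight C.counit C.counit_smul

theorem cofreeCounit_op_smul (a : A) (z : BalTensor k A N C.carrier) :
    C.cofreeCounit N (op a • z) = op a • C.cofreeCounit N z :=
  contractRight_op_smul C.counit C.counit_smul C.counit_op_smul a z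

theorem cofreeCounit_mapLeft {N' : Type u} [AddCommGroup N'] [Module k N'] [Module Aᵐᵒᵖ N']
    [IsScalarTower k Aᵐᵒᵖ N'] (g : N →ₗ[k] N')
    (hg : ∀ (a : A) (n : N), g (op a • n) = op a • g n) (z : BalTensor k A N C.carrier) :
    C.cofreeCounit N' (mapLeft g hg z) = g (C.cofreeCounit N z) :=
  contractRight_mapLeft C.counit C.counit_smul g hg z

theorem mapLeft_cofreeCounit_tensorCoact (z : BalTensor k A N C.carrier) :
    mapLeft (C.cofreeCounit N) C.cofreeCounit_op_smul (tensorCoact N C.comul C.comul_smul z) =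
      z :=
  LinearMap.congr_fun (hom_ext (g := LinearMap.id)
    (f := (mapLeft (C.cofreeCounit N) C.cofreeCounit_op_smul).comp (tensorCoact N C.comul _))
    fun n c => by
      rw [LinearMap.comp_apply, tensorCoact_tmul, assoc_symm_tmul_eq_mapLeft, mapLeft_mapLeft,
        mapLeft_eq_tmul_contractLeft n C.counit C.counit_op_smul _ _ fun _ => rfl, C.counit_comul,
        LinearMap.id_apply]) z

/-- The colinear map `C → N ⊗_A C`, `c ↦ n ⊗ c`. -/
def tmulHom (n : N) : C.regular ⟶ C.cofree N :=
  RComod.Hom.mk (M := C.regular) (N := C.cofree N) (BalTensor.mk k A N C.carrier n)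
    (mk_op_smul (N := C.carrier) n) fun c =>
      (tensorCoact_tmul C.comul C.comul_smul n c).trans (assoc_symm_tmul_eq_mapLeft n (C.comul c))

/-- Left multiplication by `a`, as a colinear endomorphism of `C`. -/
def lmulHom (a : A) : C.regular ⟶ C.regular :=
  let lmul : C.carrier →ₗ[k] C.carrier := Module.toModuleEnd k (S := A) C.carrier a
  RComod.Hom.mk (M := C.regular) (N := C.regular) lmul
    (fun b (c : C.carrier) => smul_comm a (op b) c) fun c => C.comul_smul a c

end Coring

namespace RComod

theorem tensorCoact_coact (X : RComod C) (x : X.carrier) :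
    tensorCoact X.carrier C.comul C.comul_smul (X.coact x) =
      mapLeft X.coact X.coact_op_smul (X.coact x) := by
  rw [tensorCoact, LinearMap.comp_apply, LinearEquiv.coe_coe, LinearEquiv.symm_apply_eq, X.coassoc]

/-- The coaction of `X`, as a colinear map `X → X ⊗_A C`. -/
def coactHom (X : RComod C) : X ⟶ C.cofree X.carrier :=
  Hom.mk (N := C.cofree X.carrier) X.coact X.coact_op_smul X.tensorCoact_coact

variable {X : RComod C}

/-- The colinear map `x ↦ g(x⁽⁰⁾) ⊗ x⁽¹⁾` corresponding to a right `A`-linear map `g : X → N`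
under the universal property of the cofree comodule. -/
def toCofree (g : X.carrier →ₗ[k] N) (hg : ∀ (a : A) (x : X.carrier), g (op a • x) = op a • g x) :
    X ⟶ C.cofree N :=
  Hom.mk (N := C.cofree N) ((mapLeft g hg).comp X.coact)
    (fun a x => (congrArg (mapLeft g hg) (X.coact_op_smul a x)).trans (mapLeft_op_smul g hg a _))
    fun x => by
      refine (tensorCoact_mapLeft C.comul C.comul_smul g hg (X.coact x)).trans ?_
      rw [X.tensorCoact_coact, mapLeft_mapLeft]
      rfl

theorem cofreeCounit_toCofree (g : X.carrier →ₗ[k] N)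
    (hg : ∀ (a : A) (x : X.carrier), g (op a • x) = op a • g x) (x : X.carrier) :
    C.cofreeCounit N (Hom.lin (toCofree g hg) x) = g x :=
  (C.cofreeCounit_mapLeft g hg (X.coact x)).trans (congrArg g (X.counit x))

theorem cofreeCounit_lin_op_smul (f : X ⟶ C.cofree N) (a : A) (x : X.carrier) :
    C.cofreeCounit N (Hom.lin f (op a • x)) = op a • C.cofreeCounit N (Hom.lin f x) :=
  (congrArg _ (Hom.lin_op_smul f a x)).trans (C.cofreeCounit_op_smul a _)

theorem toCofree_cofreeCounit_comp_lin (f : X ⟶ C.cofree N) :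
    toCofree ((C.cofreeCounit N).comp (Hom.lin f)) (cofreeCounit_lin_op_smul f) = f :=
  hom_ext fun x => by
    refine (mapLeft_mapLeft (Hom.lin f) (Hom.lin_op_smul f) (C.cofreeCounit N)
      C.cofreeCounit_op_smul (X.coact x)).symm.trans ?_
    rw [← Hom.coact_lin]
    exact C.mapLeft_cofreeCounit_tensorCoact _

theorem cofree_hom_ext {f g : X ⟶ C.cofree N}
    (h : ∀ x, C.cofreeCounit N (Hom.lin f x) = C.cofreeCounit N (Hom.lin g x)) : f = g := by
  rw [← toCofree_cofreeCounit_comp_lin f, ← toCofree_cofreeCounit_comp_lin g]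
  exact hom_ext fun x =>
    mapLeft_congr (LinearMap.ext h) (cofreeCounit_lin_op_smul f) (cofreeCounit_lin_op_smul g) _

end RComod

end Cofree

section NaturalEndomorphisms

variable {k A : Type u} [CommRing k] [Ring A] [Algebra k A] {C : Coring k A}

namespace RComod

/-- Naturality of a family of `k`-linear endomorphisms of the modules underlying all right
`C`-comodules, that is, the property of being an endomorphism of the forgetful functor. -/
def IsNaturalEnd (ζ : ∀ M : RComod C, M.carrier →ₗ[k] M.carrier) : Prop :=
  ∀ ⦃M N : RComod C⦄ (f : M ⟶ N) (m : M.carrier), ζ N (Hom.lin f m) = Hom.lin f (ζ M m)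

/-- The component at the regular comodule `C`, as an endomorphism of the module `C`. -/
def onRegular (ζ : ∀ M : RComod C, M.carrier →ₗ[k] M.carrier) : C.carrier →ₗ[k] C.carrier :=
  ζ C.regular

/-- The action `m ↦ m⁽⁰⁾ f(m⁽¹⁾)` of the left dual `*C = _A Hom(C, A)` on a right comodule. -/
def dualAct (f : C.carrier →ₗ[k] A) (hf : ∀ (a : A) (c : C.carrier), f (a • c) = a * f c)
    (M : RComod C) : M.carrier →ₗ[k] M.carrier :=
  (contractRight f hf).comp M.coact

variable (f : C.carrier →ₗ[k] A) (hf : ∀ (a : A) (c : C.carrier), f (a • c) = a * f c)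

theorem dualAct_isNaturalEnd : IsNaturalEnd (dualAct f hf) := fun M N g m => by
  rw [dualAct, LinearMap.comp_apply, Hom.coact_lin, contractRight_mapLeft, dualAct,
    LinearMap.comp_apply]

theorem counit_dualAct_regular (c : C.carrier) : C.counit (dualAct f hf C.regular c) = f c :=
  (apply_contractRight C.counit C.counit_op_smul f hf (C.comul c)).trans
    (congrArg f (C.counit_comul c))

namespace IsNaturalEnd

variable {ζ : ∀ M : RComod C, M.carrier →ₗ[k] M.carrier} (hζ : IsNaturalEnd ζ)
include hζ

theorem onRegular_smul (a : A) (c : C.carrier) : onRegular ζ (a • c) = a • onRegular ζ c :=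
  hζ (C.lmulHom a) c

theorem cofree_eq_mapRight {N : Type u} [AddCommGroup N] [Module k N] [Module Aᵐᵒᵖ N]
    [IsScalarTower k Aᵐᵒᵖ N] :
    ζ (C.cofree N) = mapRight (onRegular ζ) hζ.onRegular_smul :=
  BalTensor.hom_ext fun n c => hζ (C.tmulHom n) c

theorem coact_apply (M : RComod C) (m : M.carrier) :
    M.coact (ζ M m) = mapRight (onRegular ζ) hζ.onRegular_smul (M.coact m) :=
  (hζ M.coactHom m).symm.trans (LinearMap.congr_fun hζ.cofree_eq_mapRight (M.coact m))

theorem counit_comp_onRegular_smul (a : A) (c : C.carrier) :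
    C.counit.comp (onRegular ζ) (a • c) = a * C.counit.comp (onRegular ζ) c :=
  (congrArg C.counit (hζ.onRegular_smul a c)).trans (C.counit_smul a _)

theorem eq_dualAct (M : RComod C) (m : M.carrier) :
    ζ M m = dualAct (C.counit.comp (onRegular ζ)) hζ.counit_comp_onRegular_smul M m := by
  rw [dualAct, LinearMap.comp_apply, contractRight_comp C.counit C.counit_smul _ hζ.onRegular_smul,
    ← hζ.coact_apply, M.counit]

end IsNaturalEnd

end RComod

end NaturalEndomorphisms

section Yoneda

variable {k A L : Type u} [CommRing k] [Ring A] [Algebra k A] [Ring L] [Algebra k L]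
  {C : Coring k A} {D : Coring k L}

namespace BiComod

/-- The `D`-colinear maps `p : D → G(Σ)` that are left `L`-linear with respect to the left action
of `L` on `G(Σ)` by functoriality. -/
def LHom (S : BiComod L C) (G : RComod C ⥤ RComod D) :
    Submodule k (D.regular ⟶ G.obj S.toRComod) where
  carrier := {p | ∀ l : L, D.lmulHom l ≫ p = p ≫ G.map (S.lmul l)}
  zero_mem' _ := Limits.comp_zero.trans Limits.zero_comp.symm
  add_mem' hp hq l := by rw [Preadditive.comp_add, Preadditive.add_comp, hp, hq]
  smul_mem' c p hp l := by rw [Linear.comp_smul, Linear.smul_comp, hp]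

variable {S : BiComod L C} {G : RComod C ⥤ RComod D}

variable (S D) in
/-- The colinear map `D → Hom^C(Σ, M) ⊗_L D`, `d ↦ φ ⊗ d`. -/
def tmulHom {M : RComod C} (φ : S.toRComod ⟶ M) : D.regular ⟶ (S.V D).obj M :=
  D.tmulHom φ

theorem lmulHom_comp_tmulHom (l : L) {M : RComod C} (φ : S.toRComod ⟶ M) :
    D.lmulHom l ≫ S.tmulHom D φ = S.tmulHom D (S.lmul l ≫ φ) :=
  RComod.hom_ext fun (d : D.carrier) => (smul_tmul φ l d).symm

theorem tmulHom_comp_V_map {M N : RComod C} (φ : S.toRComod ⟶ M) (f : M ⟶ N) :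
    S.tmulHom D φ ≫ (S.V D).map f = S.tmulHom D (φ ≫ f) := (rfl)

theorem tmulHom_comp_app (η : S.V D ⟶ G) {M : RComod C} (φ : S.toRComod ⟶ M) :
    S.tmulHom D φ ≫ η.app M = (S.tmulHom D (𝟙 S.toRComod) ≫ η.app S.toRComod) ≫ G.map φ := by
  rw [Category.assoc, ← η.naturality, ← Category.assoc, tmulHom_comp_V_map, Category.id_comp]

theorem tmulHom_id_comp_app_mem (η : S.V D ⟶ G) :
    S.tmulHom D (𝟙 S.toRComod) ≫ η.app S.toRComod ∈ S.LHom G := fun l => by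
  rw [← tmulHom_comp_app, ← Category.assoc, lmulHom_comp_tmulHom, Category.comp_id]

theorem V_hom_ext {η θ : S.V D ⟶ G}
    (h : S.tmulHom D (𝟙 S.toRComod) ≫ η.app S.toRComod =
      S.tmulHom D (𝟙 S.toRComod) ≫ θ.app S.toRComod) : η = θ := by
  ext M : 2
  refine RComod.hom_ext <| LinearMap.congr_fun <| BalTensor.hom_ext fun φ d => ?_
  refine congrArg (fun f => RComod.Hom.lin f d) (?_ : S.tmulHom D φ ≫ _ = S.tmulHom D φ ≫ _)
  rw [tmulHom_comp_app, h, ← tmulHom_comp_app]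

namespace LHom

variable [G.Additive] [G.Linear k] (p : S.LHom G)

/-- The map `φ ⊗ d ↦ G(φ)(p(d))`. -/
def evalLin (M : RComod C) :
    BalTensor k L (S.toRComod ⟶ M) D.carrier →ₗ[k] (G.obj M).carrier :=
  lift ((RComod.homs D.regular (G.obj M)).subtype ∘ₗ Linear.leftComp k (G.obj M) p.1 ∘ₗ
      G.mapLinearMap k) fun φ l d =>
    congrArg (fun f => RComod.Hom.lin f d)
      (by rw [op_smul_def, G.map_comp, ← Category.assoc, ← p.2, Category.assoc] :
        p.1 ≫ G.map (op l • φ) = D.lmulHom l ≫ p.1 ≫ G.map φ)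

theorem evalLin_op_smul (M : RComod C) (l : L)
    (z : BalTensor k L (S.toRComod ⟶ M) D.carrier) :
    evalLin p M (op l • z) = op l • evalLin p M z := by
  induction z using BalTensor.induction with
  | zero => simp only [smul_zero, map_zero]
  | tmul φ d =>
    rw [right_smul_tmul]
    exact RComod.Hom.lin_op_smul (p.1 ≫ G.map φ) l d
  | add y z hy hz => simp only [smul_add, map_add, hy, hz]

theorem coact_evalLin (M : RComod C) (z : BalTensor k L (S.toRComod ⟶ M) D.carrier) :
    (G.obj M).coact (evalLin p M z) = mapLeft (evalLin p M) (evalLin_op_smul p M)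
      (tensorCoact (S.toRComod ⟶ M) D.comul D.comul_smul z) :=
  LinearMap.congr_fun (BalTensor.hom_ext (f := (G.obj M).coact ∘ₗ evalLin p M)
    (g := mapLeft (evalLin p M) (evalLin_op_smul p M) ∘ₗ tensorCoact _ D.comul D.comul_smul)
    fun φ d => by
      refine (RComod.Hom.coact_lin (p.1 ≫ G.map φ) d).trans ?_
      rw [LinearMap.comp_apply, tensorCoact_tmul, assoc_symm_tmul_eq_mapLeft, mapLeft_mapLeft]
      rfl) z

/-- The natural transformation `V → G` with components `φ ⊗ d ↦ G(φ)(p(d))`. -/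
def toNat : S.V D ⟶ G where
  app M := RComod.Hom.mk (M := S.VObj D M) (evalLin p M) (evalLin_op_smul p M) (coact_evalLin p M)
  naturality _ _ f := RComod.hom_ext <| LinearMap.congr_fun <| BalTensor.hom_ext fun φ d =>
    congrArg (fun g => RComod.Hom.lin (p.1 ≫ g) d) (G.map_comp φ f)

theorem tmulHom_id_comp_toNat_app :
    S.tmulHom D (𝟙 S.toRComod) ≫ (toNat p).app S.toRComod = p.1 :=
  RComod.hom_ext fun d =>
    congrArg (fun f => RComod.Hom.lin f d) (by rw [G.map_id, Category.comp_id] :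
      p.1 ≫ G.map (𝟙 S.toRComod) = p.1)

variable (S G) in
/-- The Yoneda isomorphism between the left `L`-linear colinear maps `D → G(Σ)` and `Nat(V, G)`. -/
def equivNat : S.LHom G ≃ₗ[k] (S.V D ⟶ G) :=
  LinearEquiv.symm
  { toFun η := ⟨S.tmulHom D (𝟙 S.toRComod) ≫ η.app S.toRComod, tmulHom_id_comp_app_mem η⟩
    map_add' _ _ := Subtype.ext (Preadditive.comp_add _ _ _ _ _ _)
    map_smul' _ _ := Subtype.ext (Linear.comp_smul _ _ _ _ _ _)
    invFun := toNat
    left_inv _ := V_hom_ext (tmulHom_id_comp_toNat_app _)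
    right_inv p := Subtype.ext (tmulHom_id_comp_toNat_app p) }

theorem equivNat_symm_comp {G' : RComod C ⥤ RComod D} [G'.Additive] [G'.Linear k] (θ : G ⟶ G') :
    ((equivNat S G').symm (equivNat S G p ≫ θ)).1 = p.1 ≫ θ.app S.toRComod :=
  (Category.assoc _ _ _).symm.trans
    (congrArg (· ≫ θ.app S.toRComod) (tmulHom_id_comp_toNat_app p))

end LHom

end BiComod

end Yoneda

section CounitV

variable {k A L : Type u} [CommRing k] [Ring A] [Algebra k A] [Ring L] [Algebra k L]
  {C : Coring k A} {D : Coring k L} {S : BiComod L C} {F : RComod C ⥤ RComod D}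

namespace BiComod

/-- The natural maps `F(M) → Hom^C(Σ, M)` corresponding to a natural transformation `F → V` under
the universal property of the cofree comodules `V(M) = Hom^C(Σ, M) ⊗_L D`. -/
def counitV (η : F ⟶ S.V D) (M : RComod C) : (F.obj M).carrier →ₗ[k] (S.toRComod ⟶ M) :=
  (D.cofreeCounit (S.toRComod ⟶ M)).comp (RComod.Hom.lin (η.app M))

theorem counitV_op_smul (η : F ⟶ S.V D) (M : RComod C) (l : L) (x : (F.obj M).carrier) :
    counitV η M (op l • x) = op l • counitV η M x :=
  RComod.cofreeCounit_lin_op_smul (N := (S.toRComod ⟶ M)) (η.app M) l x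

theorem cofreeCounit_V_map {M N : RComod C} (f : M ⟶ N)
    (z : BalTensor k L (S.toRComod ⟶ M) D.carrier) :
    D.cofreeCounit (S.toRComod ⟶ N)
        (RComod.Hom.lin (M := (S.V D).obj M) (N := (S.V D).obj N) ((S.V D).map f) z) =
      D.cofreeCounit (S.toRComod ⟶ M) z ≫ f :=
  D.cofreeCounit_mapLeft (S.postcomp f) (S.postcomp_op_smul f) z

theorem counitV_naturality (η : F ⟶ S.V D) {M N : RComod C} (f : M ⟶ N) (x : (F.obj M).carrier) :
    counitV η N (RComod.Hom.lin (F.map f) x) = counitV η M x ≫ f :=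
  (congrArg (fun g => D.cofreeCounit (S.toRComod ⟶ N) (RComod.Hom.lin g x)) (η.naturality f)).trans
    (cofreeCounit_V_map f _)

theorem counitV_ext {η θ : F ⟶ S.V D} (h : ∀ M x, counitV η M x = counitV θ M x) : η = θ := by
  ext M : 2
  exact RComod.cofree_hom_ext (N := (S.toRComod ⟶ M)) (h M)

/-- The natural transformation `F → V` corresponding to a natural family of right `L`-linear maps
`F(M) → Hom^C(Σ, M)`. -/
def natToV (g : ∀ M : RComod C, (F.obj M).carrier →ₗ[k] (S.toRComod ⟶ M))
    (hg : ∀ (M : RComod C) (l : L) (x : (F.obj M).carrier), g M (op l • x) = op l • g M x)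
    (hnat : ∀ ⦃M N : RComod C⦄ (f : M ⟶ N) (x : (F.obj M).carrier),
      g N (RComod.Hom.lin (F.map f) x) = g M x ≫ f) : F ⟶ S.V D where
  app M := RComod.toCofree (N := (S.toRComod ⟶ M)) (g M) (hg M)
  naturality M N f := RComod.cofree_hom_ext (N := (S.toRComod ⟶ N)) fun x =>
    ((RComod.cofreeCounit_toCofree (g N) (hg N) _).trans (hnat f x)).trans
      ((congrArg (· ≫ f) (RComod.cofreeCounit_toCofree (g M) (hg M) x)).symm.trans
        (cofreeCounit_V_map f _).symm)

theorem counitV_natToV (g : ∀ M : RComod C, (F.obj M).carrier →ₗ[k] (S.toRComod ⟶ M))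
    (hg : ∀ (M : RComod C) (l : L) (x : (F.obj M).carrier), g M (op l • x) = op l • g M x)
    (hnat : ∀ ⦃M N : RComod C⦄ (f : M ⟶ N) (x : (F.obj M).carrier),
      g N (RComod.Hom.lin (F.map f) x) = g M x ≫ f) (M : RComod C) (x : (F.obj M).carrier) :
    counitV (natToV g hg hnat) M x = g M x :=
  RComod.cofreeCounit_toCofree (g M) (hg M) x

end BiComod

end CounitV

section NatVV

variable {k A L : Type u} [CommRing k] [Ring A] [Algebra k A] [Ring L] [Algebra k L]
  {C : Coring k A} {D : Coring k L} {S : BiComod L C}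

namespace LHomL

/-- The colinear map `d ↦ v(d₁) ⊗ d₂` from `D` to `V(Σ) = T ⊗_L D`. -/
def toHom (v : LHomL D S) : D.regular ⟶ (S.V D).obj S.toRComod :=
  RComod.toCofree (X := D.regular) (N := (S.toRComod ⟶ S.toRComod)) v.1 v.2.2

theorem cofreeCounit_toHom (v : LHomL D S) (d : D.carrier) :
    D.cofreeCounit (S.toRComod ⟶ S.toRComod) (RComod.Hom.lin (toHom v) d) = v.1 d :=
  RComod.cofreeCounit_toCofree (X := D.regular) v.1 v.2.2 d

variable (D S) in
/-- The isomorphism between `_L Hom_L(D, T)` and the left `L`-linear colinear maps `D → V(Σ)`. -/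
def equivLHom : LHomL D S ≃ₗ[k] S.LHom (S.V D) :=
  LinearEquiv.symm
  { toFun p := ⟨(D.cofreeCounit (S.toRComod ⟶ S.toRComod)).comp (RComod.Hom.lin p.1),
      fun l d => (congrArg (fun f => D.cofreeCounit (S.toRComod ⟶ S.toRComod)
        (RComod.Hom.lin f d)) (p.2 l)).trans (BiComod.cofreeCounit_V_map (S.lmul l) _),
      RComod.cofreeCounit_lin_op_smul (X := D.regular) p.1⟩
    map_add' _ _ := Subtype.ext <| LinearMap.ext fun _ => map_add (D.cofreeCounit _) _ _
    map_smul' _ _ := Subtype.ext <| LinearMap.ext fun _ => map_smul (D.cofreeCounit _) _ _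
    invFun v := ⟨toHom v, fun l =>
      RComod.cofree_hom_ext (N := (S.toRComod ⟶ S.toRComod)) fun (d : D.carrier) =>
        ((cofreeCounit_toHom v (l • d)).trans (v.2.1 l d)).trans
          ((congrArg (· ≫ S.lmul l) (cofreeCounit_toHom v d)).symm.trans
            (BiComod.cofreeCounit_V_map (S.lmul l) _).symm)⟩
    left_inv p := Subtype.ext <| RComod.toCofree_cofreeCounit_comp_lin (X := D.regular) p.1
    right_inv v := Subtype.ext <| LinearMap.ext <| cofreeCounit_toHom v }

variable (D S) in
/-- The isomorphism `α₁ : _L Hom_L(D, T) → Nat(V, V)`. -/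
def equivNat : LHomL D S ≃ₗ[k] (S.V D ⟶ S.V D) :=
  (equivLHom D S).trans (BiComod.LHom.equivNat S (S.V D))

theorem counitV_equivNat_tmul (v : LHomL D S) {M : RComod C} (φ : S.toRComod ⟶ M)
    (d : D.carrier) :
    BiComod.counitV (equivNat D S v) M (tmul k L φ d) = v.1 d ≫ φ :=
  (BiComod.cofreeCounit_V_map φ _).trans (congrArg (· ≫ φ) (cofreeCounit_toHom v d))

end LHomL

end NatVV

section NatVU

variable {k A L : Type u} [CommRing k] [Ring A] [Algebra k A] [Ring L] [Algebra k L]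
  {C : Coring k A} {D : Coring k L}
  [Module Lᵐᵒᵖ C.carrier] [IsScalarTower k Lᵐᵒᵖ C.carrier] [SMulCommClass A Lᵐᵒᵖ C.carrier]
  {E : CoringExtension C D} {hE : E.IsPure} {S : BiComod L C}

theorem LHomD_eq_LHom : LHomD hE S = S.LHom hE.U :=
  Submodule.ext fun _ => forall_congr' fun _ =>
    ⟨fun h => RComod.hom_ext h, fun h d => congrArg (fun f => RComod.Hom.lin f d) h⟩

variable (hE S) in
/-- The isomorphism `α₃ : _L Hom^D(D, Σ) → Nat(V, U)`. -/
def LHomD.equivNat : LHomD hE S ≃ₗ[k] (S.V D ⟶ hE.U) :=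
  (LinearEquiv.ofEq _ _ LHomD_eq_LHom).trans (BiComod.LHom.equivNat S hE.U)

end NatVU

section NatUU

variable {k A L : Type u} [CommRing k] [Ring A] [Algebra k A] [Ring L] [Algebra k L]
  {C : Coring k A} {D : Coring k L}
  [Module Lᵐᵒᵖ C.carrier] [IsScalarTower k Lᵐᵒᵖ C.carrier] [SMulCommClass A Lᵐᵒᵖ C.carrier]
  {E : CoringExtension C D}

namespace CoringExtension

variable (E) in
/-- The identity map from the `D`-comodule `C` to `U C`. -/
def toRes : C.carrier →ₗ[k] E.Res C.regular := LinearMap.id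

variable (E) in
/-- The identity map from `U C` to the `D`-comodule `C`. -/
def ofRes : E.Res C.regular →ₗ[k] C.carrier := LinearMap.id

theorem toRes_op_smul (l : L) (c : C.carrier) : E.toRes (op l • c) = op l • E.toRes c :=
  E.rho_injective C.regular <| by
    rw [E.rho_op_smul]
    exact E.comul_op_smul l c

theorem ofRes_op_smul (l : L) (c : E.Res C.regular) : E.ofRes (op l • c) = op l • E.ofRes c :=
  (E.toRes_op_smul l (E.ofRes c)).symm

variable (hE : E.IsPure)
include hE

theorem IsPure.tau_regular (c : C.carrier) :
    hE.tau C.regular (E.toRes c) = mapLeft E.toRes E.toRes_op_smul (E.coact c) :=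
  hE.rhoD_injective C.regular <| by
    rw [hE.rhoD_tau]
    refine Eq.trans ?_ (mapLeft_mapLeft _ _ _ _ _).symm
    rw [coactC, tensorCoact, LinearMap.comp_apply, LinearEquiv.coe_coe,
      LinearEquiv.symm_apply_eq]
    exact (E.compat c).symm

theorem IsPure.coact_ofRes (c : E.Res C.regular) :
    E.coact (E.ofRes c) = mapLeft E.ofRes E.ofRes_op_smul (hE.tau C.regular c) := by
  refine Eq.trans ?_ (congrArg _ (hE.tau_regular (E.ofRes c)).symm)
  refine Eq.trans ?_ (mapLeft_mapLeft _ _ _ _ _).symm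
  exact (mapLeft_id (fun _ _ => rfl) _).symm

/-- The isomorphism of `D`-comodules from `C` to `U C`. -/
def IsPure.toU : E.comodC ⟶ hE.U.obj C.regular :=
  RComod.Hom.mk (M := E.comodC) (N := hE.obj C.regular) E.toRes E.toRes_op_smul hE.tau_regular

/-- The inverse of `IsPure.toU`. -/
def IsPure.ofU : hE.U.obj C.regular ⟶ E.comodC :=
  RComod.Hom.mk (M := hE.obj C.regular) (N := E.comodC) E.ofRes E.ofRes_op_smul hE.coact_ofRes

end CoringExtension

namespace EndCD

variable (u : EndCD E)

theorem endLin_smul (a : A) (c : C.carrier) : endLin E u.1 (a • c) = a • endLin E u.1 c :=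
  u.2.1 a c

theorem endLin_op_smul (l : L) (c : C.carrier) :
    endLin E u.1 (op l • c) = op l • endLin E u.1 c :=
  RComod.Hom.lin_op_smul (M := E.comodC) (N := E.comodC) u.1 l c

theorem coact_endLin (c : C.carrier) :
    E.coact (endLin E u.1 c) = mapLeft (endLin E u.1) (endLin_op_smul u) (E.coact c) :=
  RComod.Hom.coact_lin (M := E.comodC) (N := E.comodC) u.1 c

theorem comul_endLin (c : C.carrier) :
    C.comul (endLin E u.1 c) = mapRight (endLin E u.1) (endLin_smul u) (C.comul c) := by
  obtain ⟨_, h⟩ := u.2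
  exact h c

theorem counit_endLin_smul (a : A) (c : C.carrier) :
    C.counit.comp (endLin E u.1) (a • c) = a * C.counit.comp (endLin E u.1) c :=
  (congrArg C.counit (endLin_smul u a c)).trans (C.counit_smul a _)

/-- The endomorphism `m ↦ m⁽⁰⁾ ε(u(m⁽¹⁾))` of the right `L`-module underlying a comodule `M`. -/
def onRes (M : RComod C) : E.Res M →ₗ[k] E.Res M :=
  RComod.dualAct (C.counit.comp (endLin E u.1)) (counit_endLin_smul u) M

theorem onRes_toRes (c : C.carrier) : onRes u C.regular (E.toRes c) = endLin E u.1 c := by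
  refine (contractRight_comp C.counit C.counit_smul _ (endLin_smul u) (C.comul c)).trans ?_
  rw [← comul_endLin, C.comul_counit]

theorem rho_onRes (M : RComod C) (m : E.Res M) :
    E.rho M (onRes u M m) = mapRight (endLin E u.1) (endLin_smul u) (E.rho M m) := by
  refine ((RComod.dualAct_isNaturalEnd _ (counit_endLin_smul u)).coact_apply M m).trans ?_
  have h : RComod.onRegular (RComod.dualAct _ (counit_endLin_smul u)) = endLin E u.1 :=
    LinearMap.ext (onRes_toRes u)
  simp only [h]
  rfl

theorem onRes_op_smul (M : RComod C) (l : L) (m : E.Res M) :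
    onRes u M (op l • m) = op l • onRes u M m :=
  E.rho_injective M <| by
    rw [rho_onRes, E.rho_op_smul, E.rho_op_smul, rho_onRes,
      mapRight_op_smul _ (endLin_smul u) (endLin_op_smul u)]

theorem tau_onRes (hE : E.IsPure) (M : RComod C) (m : E.Res M) :
    hE.tau M (onRes u M m) = mapLeft (onRes u M) (onRes_op_smul u M) (hE.tau M m) :=
  hE.rhoD_injective M <| by
    rw [hE.rhoD_tau, rho_onRes, CoringExtension.coactC,
      tensorCoact_mapRight _ E.coact_smul _ E.coact_smul _ (endLin_smul u) (endLin_op_smul u)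
        (coact_endLin u)]
    refine (congrArg _ (hE.rhoD_tau M m).symm).trans ?_
    refine (mapLeft_mapLeft _ _ _ _ _).trans ?_
    refine Eq.trans ?_ (mapLeft_mapLeft _ _ _ _ _).symm
    exact mapLeft_congr (LinearMap.ext fun m => (rho_onRes u M m).symm) _ _ _

/-- The natural endomorphism of `U` with components `m ↦ m⁽⁰⁾ ε(u(m⁽¹⁾))`. -/
def toNat (hE : E.IsPure) : hE.U ⟶ hE.U where
  app M := RComod.Hom.mk (M := hE.obj M) (N := hE.obj M) (onRes u M) (onRes_op_smul u M)
    (tau_onRes u hE M)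
  naturality _ _ f := RComod.hom_ext (RComod.dualAct_isNaturalEnd _ (counit_endLin_smul u) f)

variable {hE : E.IsPure}

/-- The family of `k`-linear endomorphisms underlying a natural endomorphism of `U`. -/
def natLin (η : hE.U ⟶ hE.U) (M : RComod C) : M.carrier →ₗ[k] M.carrier :=
  RComod.Hom.lin (M := hE.obj M) (N := hE.obj M) (η.app M)

theorem natLin_isNaturalEnd (η : hE.U ⟶ hE.U) :
    RComod.IsNaturalEnd (natLin η) := fun M N f (m : M.carrier) =>
  congrArg (fun g : hE.U.obj M ⟶ hE.U.obj N => RComod.Hom.lin g m) (η.naturality f)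

variable (hE) in
/-- The isomorphism `α₂ : ^C End^D(C) → Nat(U, U)`. -/
def equivNat : EndCD E ≃ₗ[k] (hE.U ⟶ hE.U) :=
  LinearEquiv.symm
  { toFun η := ⟨hE.toU ≫ η.app C.regular ≫ hE.ofU, (natLin_isNaturalEnd η).onRegular_smul,
      (natLin_isNaturalEnd η).coact_apply C.regular⟩
    map_add' _ _ := rfl
    map_smul' _ _ := rfl
    invFun u := toNat u hE
    left_inv η := by
      ext M m
      exact ((natLin_isNaturalEnd η).eq_dualAct M m).symm
    right_inv u := Subtype.ext (RComod.hom_ext (onRes_toRes u)) }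

end EndCD

end NatUU

section NatUV

variable {k A L : Type u} [CommRing k] [Ring A] [Algebra k A] [Ring L] [Algebra k L]
  {C : Coring k A} {D : Coring k L}
  [Module Lᵐᵒᵖ C.carrier] [IsScalarTower k Lᵐᵒᵖ C.carrier] [SMulCommClass A Lᵐᵒᵖ C.carrier]
  {E : CoringExtension C D} {S : BiComod L C}

namespace Qtilde

theorem ext {q q' : Qtilde S} (h : ∀ c x, dualLin S (q.1 c) x = dualLin S (q'.1 c) x) : q = q' :=
  Subtype.ext <| LinearMap.ext fun c => LinearMap.ext (h c)

variable (q : Qtilde S)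

theorem evalAt_smul (x : S.carrier) (a : A) (c : C.carrier) :
    evalAt q.1 x (a • c) = a * evalAt q.1 x c :=
  q.2.1 x a c

theorem dualLin_apply_op_smul (l : L) (c : C.carrier) (x : S.carrier) :
    dualLin S (q.1 (op l • c)) x = dualLin S (q.1 c) (l • x) := by
  obtain ⟨_, hL, _⟩ := q.2
  exact hL l c x

theorem contractRight_comul (x : S.carrier) (c : C.carrier) :
    contractRight (evalAt q.1 x) (evalAt_smul q x) (C.comul c) =
      contractLeft (dualLin S (q.1 c)) (dualLin_op_smul S (q.1 c)) (S.coact x) := by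
  obtain ⟨_, _, hq⟩ := q.2
  exact hq x c

/-- The map `m ⊗ c ↦ (x ↦ m q(c)(x))`. -/
def contract (M : RComod C) :
    BalTensor k A M.carrier C.carrier →ₗ[k] S.carrier →ₗ[k] M.carrier :=
  LinearMap.mk₂ k (fun z x => contractRight (evalAt q.1 x) (evalAt_smul q x) z)
    (fun _ _ _ => map_add _ _ _) (fun _ _ _ => map_smul _ _ _)
    (fun z x y => by
      induction z using BalTensor.induction with
      | zero => simp
      | tmul m c => simp [add_smul]
      | add z w hz hw => rw [map_add, map_add, map_add, hz, hw, add_add_add_comm])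
    (fun r z x => by
      induction z using BalTensor.induction with
      | zero => simp
      | tmul m c => simp
      | add z w hz hw => rw [map_add, map_add, hz, hw, smul_add])

variable (M : RComod C) (z : BalTensor k A M.carrier C.carrier) (x : S.carrier)

theorem contract_apply :
    contract q M z x = contractRight (evalAt q.1 x) (evalAt_smul q x) z := (rfl)

theorem contract_tmul (m : M.carrier) (c : C.carrier) :
    contract q M (tmul k A m c) x = op (dualLin S (q.1 c) x) • m := (rfl)

theorem contract_apply_op_smul (a : A) :
    contract q M z (op a • x) = op a • contract q M z x := by
  induction z using BalTensor.induction with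
  | zero => simp only [map_zero, LinearMap.zero_apply, smul_zero]
  | tmul m c => rw [contract_tmul, contract_tmul, dualLin_op_smul, op_mul, mul_smul]
  | add z w hz hw => simp only [map_add, LinearMap.add_apply, smul_add, hz, hw]

theorem contract_op_smul_apply (l : L) : contract q M (op l • z) x = contract q M z (l • x) := by
  induction z using BalTensor.induction with
  | zero => simp only [map_zero, LinearMap.zero_apply, smul_zero]
  | tmul m c => rw [right_smul_tmul, contract_tmul, contract_tmul, dualLin_apply_op_smul]
  | add z w hz hw => simp only [map_add, LinearMap.add_apply, smul_add, hz, hw]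

theorem mapLeft_contract :
    mapLeft (contract q M z) (fun a x => contract_apply_op_smul q M z x a) (S.coact x) =
      mapRight (contractRight (evalAt q.1 x) (evalAt_smul q x))
        (contractRight_smul (evalAt q.1 x) (evalAt_smul q x))
        (mapRight C.comul C.comul_smul z) := by
  induction z using BalTensor.induction with
  | zero =>
    rw [mapLeft_congr (map_zero (contract q M)) _ (fun _ _ => (smul_zero _).symm), mapLeft_zero,
      map_zero, map_zero]
  | tmul m c =>
    rw [mapRight_tmul, mapRight_tmul, contractRight_comul]
    exact mapLeft_eq_tmul_contractLeft m _ _ _ _ (fun x => contract_tmul q M x m c) _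
  | add y z hy hz =>
    have hyz (a : A) (x : S.carrier) : (contract q M y + contract q M z) (op a • x) =
        op a • (contract q M y + contract q M z) x := by
      rw [← map_add, contract_apply_op_smul]
    rw [mapLeft_congr (map_add (contract q M) y z) _ hyz,
      mapLeft_add (fun a x => contract_apply_op_smul q M y x a)
        (fun a x => contract_apply_op_smul q M z x a) hyz, hy, hz, map_add, map_add]

theorem coact_contract (m : M.carrier) :
    M.coact (contract q M (M.coact m) x) = mapLeft (contract q M (M.coact m))
      (fun a x => contract_apply_op_smul q M _ x a) (S.coact x) := by
  rw [mapLeft_contract, contract_apply, ← contractRight_mapLeft _ _ M.coact M.coact_op_smul,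
    contractRight_assoc, M.coassoc]

/-- The map `m ↦ (x ↦ m⁽⁰⁾ q(m⁽¹⁾)(x))`. -/
def hom (M : RComod C) : M.carrier →ₗ[k] (S.toRComod ⟶ M) where
  toFun m := RComod.Hom.mk (contract q M (M.coact m))
    (fun a x => contract_apply_op_smul q M _ x a) (coact_contract q M · m)
  map_add' m n := RComod.hom_ext fun x =>
    congrArg (contract q M · x) (map_add M.coact m n) |>.trans <|
      LinearMap.congr_fun (map_add (contract q M) _ _) x
  map_smul' r m := RComod.hom_ext fun x =>
    congrArg (contract q M · x) (map_smul M.coact r m) |>.trans <|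
      LinearMap.congr_fun (map_smul (contract q M) _ _) x

theorem hom_naturality {M N : RComod C} (f : M ⟶ N) (m : M.carrier) :
    hom q N (RComod.Hom.lin f m) = hom q M m ≫ f :=
  RComod.hom_ext fun x => RComod.dualAct_isNaturalEnd _ (evalAt_smul q x) f m

theorem lin_hom_regular (c : C.carrier) :
    RComod.Hom.lin (hom q C.regular c) x =
      contractLeft (dualLin S (q.1 c)) (dualLin_op_smul S (q.1 c)) (S.coact x) :=
  contractRight_comul q x c

theorem counit_lin_hom_regular (c : C.carrier) :
    C.counit (RComod.Hom.lin (hom q C.regular c) x) = dualLin S (q.1 c) x :=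
  RComod.counit_dualAct_regular (evalAt q.1 x) (evalAt_smul q x) c

variable (E) in
/-- `Qtilde.hom q M` on the right `L`-module underlying `M`. -/
def homRes : E.Res M →ₗ[k] (S.toRComod ⟶ M) := hom q M

theorem homRes_op_smul (l : L) (m : E.Res M) : homRes E q M (op l • m) = op l • homRes E q M m :=
  RComod.hom_ext fun x => (congrArg (contract q M · x) (E.rho_op_smul M l m)).trans
    (contract_op_smul_apply q M (M.coact m) x l)

theorem homRes_toRes_op_smul (l : L) (c : C.carrier) :
    (homRes E q C.regular ∘ₗ E.toRes) (op l • c) = op l • (homRes E q C.regular ∘ₗ E.toRes) c :=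
  (congrArg (homRes E q C.regular) (E.toRes_op_smul l c)).trans
    (homRes_op_smul q C.regular l (E.toRes c))

/-- The natural transformation `U → V` corresponding to the maps `Qtilde.hom q M`. -/
def toNat (hE : E.IsPure) : hE.U ⟶ S.V D :=
  BiComod.natToV (F := hE.U) (homRes E q) (homRes_op_smul q) fun _ _ => hom_naturality q

theorem counitV_toNat (hE : E.IsPure) (m : E.Res M) :
    BiComod.counitV (F := hE.U) (toNat q hE) M m = homRes E q M m :=
  BiComod.counitV_natToV (F := hE.U) (homRes E q) (homRes_op_smul q)
    (fun _ _ => hom_naturality q) M m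

theorem lin_toNat_app_regular (hE : E.IsPure) (c : C.carrier) :
    RComod.Hom.lin (M := hE.obj C.regular) (N := S.VObj D C.regular)
        ((toNat q hE).app C.regular) (E.toRes c) =
      mapLeft (homRes E q C.regular ∘ₗ E.toRes) (homRes_toRes_op_smul q) (E.coact c) :=
  (congrArg (mapLeft (homRes E q C.regular) (homRes_op_smul q C.regular))
    (hE.tau_regular c)).trans (mapLeft_mapLeft _ _ _ _ _)

variable {hE : E.IsPure} (η : hE.U ⟶ S.V D)

/-- The natural family of endomorphisms `m ↦ η(m)(x)` corresponding to a natural transformation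
`η : U → V` and an element `x` of `Σ`. -/
def natEval (x : S.carrier) (M : RComod C) : M.carrier →ₗ[k] M.carrier where
  toFun m := RComod.Hom.lin (BiComod.counitV η M m) x
  map_add' m n := congrArg (RComod.Hom.lin · x) (map_add (BiComod.counitV η M) m n)
  map_smul' r m := congrArg (RComod.Hom.lin · x) (map_smul (BiComod.counitV η M) r m)

theorem natEval_isNaturalEnd (x : S.carrier) : RComod.IsNaturalEnd (natEval η x) :=
  fun _ _ f m => congrArg (RComod.Hom.lin · x) (BiComod.counitV_naturality η f m)

/-- The map `c ↦ (x ↦ ε(η(c)(x)))`. -/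
def counitNatEval : C.carrier →ₗ[k] Dual S where
  toFun c := show S.carrier →ₗ[Aᵐᵒᵖ] A from
    { toFun x := C.counit (natEval η x C.regular c)
      map_add' x y := (congrArg C.counit (map_add (RComod.Hom.lin
        (BiComod.counitV η C.regular c)) x y)).trans (map_add C.counit _ _)
      map_smul' a x := (congrArg C.counit (RComod.Hom.lin_op_smul
        (BiComod.counitV η C.regular c) (unop a) x)).trans (C.counit_op_smul (unop a) _) }
  map_add' c c' := LinearMap.ext fun x =>
    (congrArg C.counit (map_add (natEval η x C.regular) c c')).trans (map_add C.counit _ _)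
  map_smul' r c := LinearMap.ext fun x =>
    (congrArg C.counit (map_smul (natEval η x C.regular) r c)).trans (map_smul C.counit _ _)

theorem counitNatEval_op_smul (l : L) (c : C.carrier) (x : S.carrier) :
    dualLin S (counitNatEval η (op l • c)) x = dualLin S (counitNatEval η c) (l • x) :=
  congrArg (fun φ => C.counit (RComod.Hom.lin φ x)) <|
    (congrArg (BiComod.counitV η C.regular) (E.toRes_op_smul l c)).trans
      (BiComod.counitV_op_smul η C.regular l (E.toRes c))

theorem counitNatEval_mem : counitNatEval η ∈ Qtilde S := by
  refine ⟨fun x => (natEval_isNaturalEnd η x).counit_comp_onRegular_smul,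
    counitNatEval_op_smul η, fun x c => ?_⟩
  let φ : S.toRComod ⟶ C.regular := BiComod.counitV η C.regular c
  refine ((natEval_isNaturalEnd η x).eq_dualAct C.regular c).symm.trans ?_
  refine (C.counit_comul (RComod.Hom.lin φ x)).symm.trans ?_
  refine (congrArg _ (RComod.Hom.coact_lin φ x)).trans ?_
  exact contractLeft_mapLeft C.counit C.counit_op_smul (RComod.Hom.lin φ) _ _

theorem counitNatEval_add (η θ : hE.U ⟶ S.V D) :
    counitNatEval (η + θ) = counitNatEval η + counitNatEval θ := by
  refine LinearMap.ext fun c => LinearMap.ext fun x => ?_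
  refine (congrArg (fun φ => C.counit (RComod.Hom.lin φ x))
    (map_add (D.cofreeCounit (S.toRComod ⟶ C.regular)) _ _)).trans ?_
  exact map_add C.counit _ _

theorem counitNatEval_smul (r : k) (η : hE.U ⟶ S.V D) :
    counitNatEval (r • η) = r • counitNatEval η := by
  refine LinearMap.ext fun c => LinearMap.ext fun x => ?_
  refine (congrArg (fun φ => C.counit (RComod.Hom.lin φ x))
    (map_smul (D.cofreeCounit (S.toRComod ⟶ C.regular)) r _)).trans ?_
  exact map_smul C.counit _ _

theorem dualLin_counitNatEval_toNat (q : Qtilde S) (c : C.carrier) (x : S.carrier) :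
    dualLin S (counitNatEval (toNat q hE) c) x = dualLin S (q.1 c) x :=
  (congrArg (fun φ : S.toRComod ⟶ C.regular => C.counit (RComod.Hom.lin φ x))
    (counitV_toNat q C.regular hE (E.toRes c))).trans (counit_lin_hom_regular q x c)

variable (hE S) in
/-- The isomorphism `α₄ : Q̃ → Nat(U, V)`. -/
def equivNat : Qtilde S ≃ₗ[k] (hE.U ⟶ S.V D) :=
  LinearEquiv.symm
  { toFun η := ⟨counitNatEval η, counitNatEval_mem η⟩
    map_add' η θ := Subtype.ext (counitNatEval_add η θ)
    map_smul' r η := Subtype.ext (counitNatEval_smul r η)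
    invFun q := toNat q hE
    left_inv η := BiComod.counitV_ext fun M m =>
      (counitV_toNat _ M hE m).trans <|
        RComod.hom_ext fun x => ((natEval_isNaturalEnd η x).eq_dualAct M m).symm
    right_inv q := Qtilde.ext (dualLin_counitNatEval_toNat q) }

theorem dualLin_equivNat_symm (c : C.carrier) (x : S.carrier) :
    dualLin S (((equivNat S hE).symm η).1 c) x =
      C.counit (RComod.Hom.lin (BiComod.counitV η C.regular (E.toRes c)) x) := (rfl)

end Qtilde

end NatUV

section Formulas

variable {k A L : Type u} [CommRing k] [Ring A] [Algebra k A] [Ring L] [Algebra k L]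
  {C : Coring k A} {D : Coring k L}
  [Module Lᵐᵒᵖ C.carrier] [IsScalarTower k Lᵐᵒᵖ C.carrier] [SMulCommClass A Lᵐᵒᵖ C.carrier]
  {E : CoringExtension C D} (hE : E.IsPure) (S : BiComod L C)

/-- The Morita context `M̃(Σ)`, with the structure transported from the context of natural
transformations between `V` and `U`. -/
def moritaContext : MoritaContext k (LHomL D S) (EndCD E) (LHomD hE S) (Qtilde S) :=
  (MoritaContext.ofObjects k (S.V D) hE.U).transport (LHomL.equivNat D S) (EndCD.equivNat hE)
    (LHomD.equivNat hE S) (Qtilde.equivNat S hE)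

variable {hE S} (q : Qtilde S) (v v' : LHomL D S) (p : LHomD hE S) (u u' : EndCD E)
  (c : C.carrier) (d : D.carrier) (x : S.carrier)

theorem mulR_moritaContext : ((moritaContext hE S).mulR v v').1 d = formulaVV v v' d := by
  refine (congrArg
    (fun f => D.cofreeCounit (S.toRComod ⟶ S.toRComod) (RComod.Hom.lin f d))
    (BiComod.LHom.equivNat_symm_comp (LHomL.equivLHom D S v) (LHomL.equivNat D S v'))).trans ?_
  unfold formulaVV
  refine BalTensor.eq_lift
    (f := (BiComod.counitV (LHomL.equivNat D S v') S.toRComod).comp (mapLeft v.1 v.2.2))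
    (fun d d' => ?_) (D.comul d)
  exact LHomL.counitV_equivNat_tmul v' (v.1 d) d'

theorem mulS_moritaContext :
    endLin E ((moritaContext hE S).mulS u u').1 c = endLin E u'.1 (endLin E u.1 c) :=
  (EndCD.onRes_toRes u' _).trans (congrArg (endLin E u'.1) (EndCD.onRes_toRes u c))

theorem actRP_moritaContext :
    colin hE S ((moritaContext hE S).actRP v p).1 d = formulaVP v p d := by
  refine (congrArg (fun f => colin hE S f d) (BiComod.LHom.equivNat_symm_comp
    (LHomL.equivLHom D S v) (LHomD.equivNat hE S p))).trans ?_
  unfold formulaVP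
  exact BalTensor.eq_lift (f := (RComod.Hom.lin (M := S.VObj D S.toRComod)
    (N := hE.obj S.toRComod) ((LHomD.equivNat hE S p).app S.toRComod)).comp (mapLeft v.1 v.2.2))
    (fun _ _ => rfl) (D.comul d)

theorem actPS_moritaContext :
    colin hE S ((moritaContext hE S).actPS p u).1 d = formulaPU p u d := (rfl)

theorem actSQ_moritaContext : ((moritaContext hE S).actSQ u q).1 c = q.1 (endLin E u.1 c) :=
  LinearMap.ext fun x => by
    refine (Qtilde.dualLin_equivNat_symm
      (EndCD.equivNat hE u ≫ Qtilde.equivNat S hE q) c x).trans ?_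
    refine (congrArg (fun φ : S.toRComod ⟶ C.regular => C.counit (RComod.Hom.lin φ x))
      (Qtilde.counitV_toNat q C.regular hE (EndCD.onRes u C.regular (E.toRes c)))).trans ?_
    refine (Qtilde.counit_lin_hom_regular q x _).trans ?_
    exact congrArg (fun c => dualLin S (q.1 c) x) (EndCD.onRes_toRes u c)

theorem actQR_moritaContext :
    dualLin S (((moritaContext hE S).actQR q v).1 c) x = formulaQV E q v c x := by
  refine (Qtilde.dualLin_equivNat_symm (Qtilde.equivNat S hE q ≫ LHomL.equivNat D S v) c x).trans ?_
  refine (congrArg (fun z => C.counit (RComod.Hom.lin (BiComod.counitV (LHomL.equivNat D S v)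
    C.regular z) x)) (Qtilde.lin_toNat_app_regular q hE c)).trans ?_
  unfold formulaQV
  refine BalTensor.eq_lift (f := C.counit ∘ₗ (RComod.homs S.toRComod C.regular).subtype.flip x ∘ₗ
    BiComod.counitV (LHomL.equivNat D S v) C.regular ∘ₗ
      mapLeft (Qtilde.homRes E q C.regular ∘ₗ E.toRes) (Qtilde.homRes_toRes_op_smul q))
    (fun c d => ?_) (E.coact c)
  refine (congrArg (fun φ => C.counit (RComod.Hom.lin φ x)) (LHomL.counitV_equivNat_tmul v
    (Qtilde.homRes E q C.regular (E.toRes c)) d)).trans ?_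
  exact Qtilde.counit_lin_hom_regular q (RComod.Hom.lin (v.1 d) x) c

theorem pairQP_moritaContext :
    endLin E ((moritaContext hE S).pairQP q p).1 c = formulaQPAlt q p c := by
  refine (congrArg (RComod.Hom.lin (M := S.VObj D C.regular) (N := hE.obj C.regular)
    ((LHomD.equivNat hE S p).app C.regular)) (Qtilde.lin_toNat_app_regular q hE c)).trans ?_
  unfold formulaQPAlt
  refine BalTensor.eq_lift (f := (RComod.Hom.lin (M := S.VObj D C.regular) (N := hE.obj C.regular)
    ((LHomD.equivNat hE S p).app C.regular)).comp (mapLeft (Qtilde.homRes E q C.regular ∘ₗ E.toRes)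
      (Qtilde.homRes_toRes_op_smul q)))
    (fun c d => ?_) (E.coact c)
  exact Qtilde.lin_hom_regular q (colin hE S p.1 d) c

theorem evalQP_smul (a : A) (z : BalTensor k L C.carrier D.carrier) :
    evalQP q p (a • z) = a * evalQP q p z := by
  induction z using BalTensor.induction with
  | zero => rw [smul_zero, map_zero, mul_zero]
  | tmul c d =>
    rw [left_smul_tmul]
    exact Qtilde.evalAt_smul q (colin hE S p.1 d) a c
  | add y z hy hz => rw [smul_add, map_add, map_add, hy, hz, mul_add]

theorem contractRight_evalQP_assoc_tmul (z : BalTensor k A C.carrier C.carrier) (d : D.carrier) :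
    contractRight (evalQP q p) (evalQP_smul q p) (assoc (tmul k L z d)) =
      contractRight (evalAt q.1 (colin hE S p.1 d))
        (Qtilde.evalAt_smul q (colin hE S p.1 d)) z := by
  induction z using BalTensor.induction with
  | zero => rw [zero_tmul, map_zero, map_zero, map_zero]
  | tmul c c' => rfl
  | add y z hy hz => rw [add_tmul, map_add, map_add, map_add, hy, hz]

theorem formulaQP_eq_formulaQPAlt : formulaQP q p c = formulaQPAlt q p c := by
  unfold formulaQP
  rw [contractRight_comp (evalQP q p) (evalQP_smul q p) E.coact E.coact_smul, ← E.compat]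
  unfold formulaQPAlt
  refine BalTensor.eq_lift (f := contractRight (evalQP q p) (evalQP_smul q p) ∘ₗ
    assoc.toLinearMap ∘ₗ mapLeft C.comul E.comul_op_smul) (fun c d => ?_) (E.coact c)
  refine (contractRight_evalQP_assoc_tmul q p (C.comul c) d).trans ?_
  exact Qtilde.contractRight_comul q (colin hE S p.1 d) c

theorem pairPQ_moritaContext :
    RComod.Hom.lin (((moritaContext hE S).pairPQ p q).1 d) x = formulaPQ p q d x :=
  congrArg (RComod.Hom.lin · x) (Qtilde.counitV_toNat q S.toRComod hE (colin hE S p.1 d))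

end Formulas

end

end CoringMorita

theorem mainTheorem3 {k A L : Type u} [CommRing k] [Ring A] [Algebra k A] [Ring L] [Algebra k L]
    (C : Coring k A) (D : Coring k L)
    [Module Lᵐᵒᵖ C.carrier] [IsScalarTower k Lᵐᵒᵖ C.carrier] [SMulCommClass A Lᵐᵒᵖ C.carrier]
    (E : CoringExtension C D) (hE : E.IsPure) (S : BiComod L C) :
    ∃ M : MoritaContext k (LHomL D S) (EndCD E) (LHomD hE S) (Qtilde S),
      (∀ (v v' : LHomL D S) (d : D.carrier), (M.mulR v v').1 d = formulaVV v v' d) ∧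
      (∀ (u u' : EndCD E) (c : C.carrier),
        endLin E (M.mulS u u').1 c = endLin E u'.1 (endLin E u.1 c)) ∧
      (∀ (v : LHomL D S) (p : LHomD hE S) (d : D.carrier),
        colin hE S (M.actRP v p).1 d = formulaVP v p d) ∧
      (∀ (p : LHomD hE S) (u : EndCD E) (d : D.carrier),
        colin hE S (M.actPS p u).1 d = formulaPU p u d) ∧
      (∀ (q : Qtilde S) (v : LHomL D S) (c : C.carrier) (x : S.carrier),
        dualLin S ((M.actQR q v).1 c) x = formulaQV E q v c x) ∧
      (∀ (u : EndCD E) (q : Qtilde S) (c : C.carrier),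
        (M.actSQ u q).1 c = q.1 (endLin E u.1 c)) ∧
      (∀ (q : Qtilde S) (p : LHomD hE S) (c : C.carrier),
        endLin E (M.pairQP q p).1 c = formulaQP q p c ∧
        endLin E (M.pairQP q p).1 c = formulaQPAlt q p c) ∧
      (∀ (p : LHomD hE S) (q : Qtilde S) (d : D.carrier) (x : S.carrier),
        RComod.Hom.lin ((M.pairPQ p q).1 d) x = formulaPQ p q d x) ∧
      Nonempty (M.Iso (MoritaContext.ofObjects k (S.V D) hE.U)) :=
  ⟨moritaContext hE S, mulR_moritaContext, mulS_moritaContext, actRP_moritaContext,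
    actPS_moritaContext, actQR_moritaContext, fun u q => actSQ_moritaContext q u,
    fun q p c => ⟨(pairQP_moritaContext q p c).trans (formulaQP_eq_formulaQPAlt q p c).symm,
      pairQP_moritaContext q p c⟩,
    fun p q => pairPQ_moritaContext q p, ⟨MoritaContext.transportIso _ _ _ _ _⟩⟩
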